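/- Let $R$ be a commutative Noetherian ring. For an ideal $I$ and an arbitrary $R$-module $M$ put $\operatorname{grade}(I,M)=\inf\{i\ge 0\mid \operatorname{Ext}^i_R(R/I,M)\neq 0\}\in\mathbb N\cup\{\infty\}$ and $\operatorname{grade} I=\operatorname{grade}(I,R)$. A quasi-projective resolution of an $R$-module $N$ is a bounded below complex $P$ of projective $R$-modules such that $\operatorname{H}_i(P)\cong N^{\oplus a_i}$ for all $i$, where the $a_i$ are non-negative integers, not all zero; it is finite if $P$ is bounded. For $N\ne 0$, the quasi-projective dimension $\operatorname{qpd}_R N$ is the infimum of $\sup\{i\mid P_i\ne0\}-\sup\{i\mid \operatorname{H}_i(P)\neq0\}$ over all finite quasi-projective resolutions $P$ of $N$ ($\infty$ if there are none), and $\operatorname{qpd}_R 0=-\infty$. An ideal $I$ is an FKH ideal (ideal with free Koszul homology) if, for some finite system of generators of $I$, the Koszul complex on these generators is a quasi-projective resolution of $R/I$. Theorem. Let $I$ be a proper FKH ideal of $R$. (1) One has $\operatorname{qpd}_R(R/I)=\operatorname{grade} I$. (2) Let $x_1,\dots,x_e$ be any finite sequence generating $I$, let $M$ be an $R$-module (not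 necessarily finitely generated), let $n\ge 1$ be an integer, and put $g=\min\{\operatorname{grade} I,\operatorname{grade}(I,M)\}$. If $\operatorname{Tor}^R_i(R/I,M)=0$ for all $n\le i\le n+e-g$, then $\operatorname{Tor}^R_i(R/I,M)=0$ for all $i\ge n$. -/

import Mathlib

open CategoryTheory CategoryTheory.Limits

universe u

noncomputable section

namespace QuasiProj

variable {R : Type u} [CommRing R]

/-- The linear functional `R^e → R` sending the `k`-th basis vector to `x k`. -/
def koszulFunctional {e : ℕ} (x : Fin e → R) : Module.Dual R (Fin e → R) :=
  Fintype.linearCombination R x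

/-- The differential of the Koszul complex on the whole exterior algebra of `R^e`: contraction
with the functional `e_k ↦ x k`, i.e. the unique graded derivation extending it. Explicitly,
`e_{k_1} ∧ ⋯ ∧ e_{k_p} ↦ ∑ j, (-1)^(j+1) x_{k_j} e_{k_1} ∧ ⋯ (omit e_{k_j}) ⋯ ∧ e_{k_p}`. -/
def koszulD {e : ℕ} (x : Fin e → R) :
    ExteriorAlgebra R (Fin e → R) →ₗ[R] ExteriorAlgebra R (Fin e → R) :=
  CliffordAlgebra.contractLeft (koszulFunctional x)

/-- The degree `i` piece of the exterior algebra of `R^e`: the exterior power `⋀^i R^e` for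
`i ≥ 0`, and zero for `i < 0`. -/
def koszulDegree (R : Type u) [CommRing R] (e : ℕ) :
    ℤ → Submodule R (ExteriorAlgebra R (Fin e → R))
  | Int.ofNat n => ⋀[R]^n (Fin e → R)
  | Int.negSucc _ => ⊥

theorem koszulD_ι_mul {e : ℕ} (x : Fin e → R) (v : Fin e → R)
    (y : ExteriorAlgebra R (Fin e → R)) :
    koszulD x (ExteriorAlgebra.ι R v * y) =
      koszulFunctional x v • y - ExteriorAlgebra.ι R v * koszulD x y :=
  CliffordAlgebra.contractLeft_ι_mul _ _ _

theorem koszulD_koszulD {e : ℕ} (x : Fin e → R) (y : ExteriorAlgebra R (Fin e → R)) :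
    koszulD x (koszulD x y) = 0 :=
  CliffordAlgebra.contractLeft_contractLeft _ _

theorem koszulD_eq_zero_of_mem {e : ℕ} (x : Fin e → R) {y : ExteriorAlgebra R (Fin e → R)}
    (hy : y ∈ ⋀[R]^0 (Fin e → R)) : koszulD x y = 0 := by
  rw [ExteriorAlgebra.exteriorPower, pow_zero, Submodule.mem_one] at hy
  obtain ⟨r, rfl⟩ := hy
  exact CliffordAlgebra.contractLeft_algebraMap _ (koszulFunctional x) r

theorem koszulD_mem_exteriorPower {e : ℕ} (x : Fin e → R) (n : ℕ) :
    ∀ y ∈ ⋀[R]^(n + 1) (Fin e → R), koszulD x y ∈ ⋀[R]^n (Fin e → R) := by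
  induction n with
  | zero =>
    intro y hy
    rw [ExteriorAlgebra.exteriorPower, pow_succ'] at hy
    induction hy using Submodule.mul_induction_on' with
    | mem_mul_mem a ha b hb =>
      obtain ⟨v, rfl⟩ := ha
      rw [koszulD_ι_mul, koszulD_eq_zero_of_mem x hb, mul_zero, sub_zero]
      exact Submodule.smul_mem _ _ hb
    | add a _ b _ iha ihb => rw [map_add]; exact Submodule.add_mem _ iha ihb
  | succ n ih =>
    intro y hy
    rw [ExteriorAlgebra.exteriorPower, pow_succ'] at hy
    induction hy using Submodule.mul_induction_on' with
    | mem_mul_mem a ha b hb =>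
      obtain ⟨v, rfl⟩ := ha
      rw [koszulD_ι_mul]
      refine Submodule.sub_mem _ (Submodule.smul_mem _ _ hb) ?_
      have h := Submodule.mul_mem_mul (LinearMap.mem_range_self (ExteriorAlgebra.ι R) v) (ih b hb)
      rwa [ExteriorAlgebra.exteriorPower, ← pow_succ'] at h
    | add a _ b _ iha ihb => rw [map_add]; exact Submodule.add_mem _ iha ihb

theorem koszulD_mem {e : ℕ} (x : Fin e → R) (i : ℤ) :
    ∀ y ∈ koszulDegree R e (i + 1), koszulD x y ∈ koszulDegree R e i := by
  intro y hy
  match i, hy with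
  | Int.ofNat n, hy => exact koszulD_mem_exteriorPower x n y hy
  | Int.negSucc 0, hy =>
    have h : koszulD x y = 0 := koszulD_eq_zero_of_mem x hy
    rw [h]
    exact Submodule.zero_mem _
  | Int.negSucc (n + 1), hy =>
    have h : y = 0 := (Submodule.mem_bot R).1 hy
    rw [h, map_zero]
    exact Submodule.zero_mem _

/-- The Koszul complex `K(x)` of a finite sequence `x = x_1, …, x_e` in `R`, as a chain complex
of `R`-modules indexed by `ℤ` (and zero in negative degrees). -/
def koszulComplex {e : ℕ} (x : Fin e → R) : ChainComplex (ModuleCat.{u} R) ℤ :=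
  ChainComplex.of (fun i => ModuleCat.of R (koszulDegree R e i))
    (fun i => ModuleCat.ofHom ((koszulD x).restrict (koszulD_mem x i)))
    (fun i => by
      refine ModuleCat.hom_ext (LinearMap.ext fun y => ?_)
      exact Subtype.ext (koszulD_koszulD x y.1))

/-- `P` is a quasi-projective resolution of `M`: a bounded below complex of projective modules
all of whose homology modules are finite direct sums of copies of `M`, the multiplicities not all
being zero. (Below the infimum of `P` the homology vanishes, so there one takes `a i = 0`.) -/
structure IsQuasiProjectiveResolution (P : ChainComplex (ModuleCat.{u} R) ℤ)
    (M : Type u) [AddCommGroup M] [Module R M] : Prop where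
  projective : ∀ i, Projective (P.X i)
  boundedBelow : ∃ m : ℤ, ∀ i < m, IsZero (P.X i)
  homology : ∃ a : ℤ → ℕ, (∃ i, a i ≠ 0) ∧
    ∀ i, Nonempty (P.homology i ≅ ModuleCat.of R (Fin (a i) → M))

open Classical in
/-- The quasi-projective dimension of `M`: it is `-∞` if `M = 0`, and otherwise the infimum of
`sup P - hsup P` over the finite quasi-projective resolutions `P` of `M`, where
`sup P = max {i | P_i ≠ 0}` and `hsup P = max {i | H_i(P) ≠ 0}` (so it is `∞` if there are none).
If `M ≠ 0`, then `P` has nonzero homology, so that for bounded `P` both maxima exist and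
`sup P = hsup P + d` for a natural number `d`; conversely, if `sup P` exists, `P` is bounded. -/
def qpd (R : Type u) [CommRing R] (M : Type u) [AddCommGroup M] [Module R M] : WithBot ℕ∞ :=
  if Subsingleton M then ⊥ else
    ((sInf {D : ℕ∞ | ∃ (P : ChainComplex (ModuleCat.{u} R) ℤ) (h : ℤ) (d : ℕ),
      IsQuasiProjectiveResolution P M ∧
      IsGreatest {i : ℤ | ¬ IsZero (P.X i)} (h + d) ∧
      IsGreatest {i : ℤ | ¬ IsZero (P.homology i)} h ∧
      D = d} : ℕ∞) : WithBot ℕ∞)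

/-- `grade(I, M) = inf {i | Ext^i_R(R/I, M) ≠ 0}`, for an arbitrary module `M`
(`∞` if there is no such `i`). The grade of the ideal `I` is `grade I R`. -/
def grade (I : Ideal R) (M : Type u) [AddCommGroup M] [Module R M] : ℕ∞ :=
  sInf {D : ℕ∞ | ∃ i : ℕ,
    Nontrivial (Abelian.Ext.{u} (ModuleCat.of R (R ⧸ I)) (ModuleCat.of R M) i) ∧ D = i}

/-- `I` is an ideal with free Koszul homology: for some finite system of generators of `I` the
Koszul complex is a quasi-projective resolution of `R/I`. -/
def IsFKH (I : Ideal R) : Prop :=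
  ∃ (e : ℕ) (x : Fin e → R), Ideal.span (Set.range x) = I ∧
    IsQuasiProjectiveResolution (koszulComplex x) (R ⧸ I)

end QuasiProj

end

/-! Write C_j for the cokernel of K_{j+1} → K_j (`opcycles`). Both halves read information off
Koszul homology through the sequences C_{j+1} → K_j → C_j → 0. Free homology enters only through
`InAdd`: homology modules are summands of finite sums of copies of R/I.

(1) Let K be a Koszul complex on e generators that is a quasi-projective resolution of R/I, and let
h be the top degree of its homology. The differential has coefficients in I, so it induces zero on
Ext(R/I, -). Together with exactness of K ⊗ P above h, this forces Ext^i(R/I, P) = 0 for all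
projective P and i < e - h (`subsingleton_ext_of_koszulTensor_exactAt`). Conversely, the acyclicity
lemma `hom_homology_eq_zero` shows that a complex whose terms have no Ext^i from R/I for i < g, and
whose top homology receives a nonzero map from R/I, extends at least g degrees beyond that homology.
Applied to K it gives grade I = e - h; applied to an arbitrary finite quasi-projective resolution it
gives the lower bound on qpd, which K attains.

(2) For any generators x of I, the homology of K(x) is still in add(R/I)
(`koszulComplex_homology_inAdd`): the Koszul complex on one system is a retract of the Koszul
complex on the other extended by zeros. The homology of K(x) and that of K(x) ⊗ M both vanish above
e - g (`koszulComplex_isZero_homology`, `koszulTensor_exactAt`). If Tor_i(R/I, M) = 0 for n ≤ i < m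
and m > n + e - g, then exactness of K ⊗ M in degree m gives Tor_1(C_{m-1}, M) = 0. Shifting along
the cokernels down to C_0, of which R/I is a summand, costs only vanishing of Tor_{m-q-2}(H_{q+1},
M), where either H_{q+1} = 0 or the inductive hypothesis applies (`tensorExact_opcycles`,
`isZero_tor_of_isZero_tor`). -/

noncomputable section

namespace QuasiProj

section

/-! ### Summands of finite direct sums, and Ext into them -/

section Additive

universe v₁ v₂ w₁ w₂

variable {C : Type w₁} [Category.{v₁} C] [Preadditive C]
  {D : Type w₂} [Category.{v₂} D] [Preadditive D]

/-- `Y` is a direct summand of a finite direct sum of copies of `A`, expressed without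
reference to biproducts. -/
def InAdd (A Y : C) : Prop :=
  ∃ (n : ℕ) (a : Fin n → (Y ⟶ A)) (b : Fin n → (A ⟶ Y)), ∑ k, a k ≫ b k = 𝟙 Y

lemma InAdd.of_retract {A Y : C} (a : Y ⟶ A) (b : A ⟶ Y) (h : a ≫ b = 𝟙 Y) : InAdd A Y :=
  ⟨1, fun _ => a, fun _ => b, by simpa using h⟩

lemma InAdd.retract {A Y Z : C} (h : InAdd A Y) (a : Z ⟶ Y) (b : Y ⟶ Z) (hab : a ≫ b = 𝟙 Z) :
    InAdd A Z := by
  obtain ⟨n, f, g, hfg⟩ := h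
  refine ⟨n, fun k => a ≫ f k, fun k => g k ≫ b, ?_⟩
  calc ∑ k, (a ≫ f k) ≫ g k ≫ b = a ≫ (∑ k, f k ≫ g k) ≫ b := by
        simp [Preadditive.comp_sum, Preadditive.sum_comp]
    _ = 𝟙 Z := by rw [hfg, Category.id_comp, hab]

lemma InAdd.map {A Y : C} (h : InAdd A Y) (F : C ⥤ D) [F.Additive] :
    InAdd (F.obj A) (F.obj Y) := by
  obtain ⟨n, f, g, hfg⟩ := h
  refine ⟨n, fun k => F.map (f k), fun k => F.map (g k), ?_⟩
  simp only [← F.map_comp, ← F.map_sum, hfg, F.map_id]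

lemma InAdd.isZero {A Y : C} (h : InAdd A Y) (hA : IsZero A) : IsZero Y := by
  obtain ⟨n, f, g, hfg⟩ := h
  rw [IsZero.iff_id_eq_zero, ← hfg]
  exact Finset.sum_eq_zero fun k _ => by rw [hA.eq_of_tgt (f k) 0, zero_comp]

lemma InAdd.isZero_of_hom {A Y : C} (h : InAdd A Y) (hA : ∀ f : A ⟶ Y, f = 0) : IsZero Y := by
  obtain ⟨n, f, g, hfg⟩ := h
  rw [IsZero.iff_id_eq_zero, ← hfg]
  exact Finset.sum_eq_zero fun k _ => by rw [hA (g k), comp_zero]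

end Additive

section Ext

universe v w w'

variable {C : Type w} [Category.{v} C] [Abelian C] [HasExt.{w'} C]

open Abelian

lemma InAdd.subsingleton_ext {A Y : C} (h : InAdd A Y) {X : C} {i : ℕ}
    [Subsingleton (Ext.{w'} X A i)] : Subsingleton (Ext.{w'} X Y i) := by
  obtain ⟨n, f, g, hfg⟩ := h
  refine subsingleton_of_forall_eq 0 fun α => ?_
  rw [← Ext.comp_mk₀_id α, ← hfg, Ext.mk₀_sum, Ext.comp_sum]
  refine Finset.sum_eq_zero fun k _ => ?_
  rw [← Ext.mk₀_comp_mk₀, ← Ext.comp_assoc_of_third_deg_zero,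
    Subsingleton.elim (α.comp (Ext.mk₀ (f k)) (add_zero i)) 0, Ext.zero_comp]

lemma subsingleton_ext_of_isZero {X Y : C} (h : IsZero Y) (i : ℕ) :
    Subsingleton (Ext.{w'} X Y i) := by
  refine subsingleton_of_forall_eq 0 fun α => ?_
  rw [← Ext.comp_mk₀_id α, (IsZero.iff_id_eq_zero Y).1 h, Ext.mk₀_zero, Ext.comp_zero]

lemma subsingleton_ext_zero_iff {X Y : C} :
    Subsingleton (Ext.{w'} X Y 0) ↔ ∀ f : X ⟶ Y, f = 0 := by
  rw [Ext.homEquiv₀.subsingleton_congr]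
  exact ⟨fun h f => Subsingleton.elim f 0, fun h => subsingleton_of_forall_eq 0 h⟩

end Ext

/-! ### Ext along the cokernels of a complex; the acyclicity lemma -/

section Complex

universe v w w'

variable {C : Type w} [Category.{v} C] [Abelian C] (K : ChainComplex C ℤ)

lemma mono_fromOpcycles {j : ℤ} (h : K.ExactAt (j + 1)) : Mono (K.fromOpcycles (j + 1) j) := by
  have hk : ∀ k, (ComplexShape.down ℤ).next (j + 1) = k → Mono (K.fromOpcycles (j + 1) k) := by
    rintro _ rfl
    exact ShortComplex.Exact.mono_fromOpcycles h
  exact hk j (by simp)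

/-- The sequence `coker (d : K_{j+2} ⟶ K_{j+1}) ⟶ K_j ⟶ coker (d : K_{j+1} ⟶ K_j)`. -/
abbrev opcyclesSequence (j : ℤ) : ShortComplex C where
  X₁ := K.opcycles (j + 1)
  X₂ := K.X j
  X₃ := K.opcycles j
  f := K.fromOpcycles (j + 1) j
  g := K.pOpcycles j
  zero := by rw [← cancel_epi (K.pOpcycles (j + 1))]; simp

lemma opcyclesSequence_exact (j : ℤ) : (opcyclesSequence K j).Exact := by
  have hT : (ShortComplex.mk (K.d (j + 1) j) (K.pOpcycles j) (K.d_pOpcycles _ _)).Exact :=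
    ShortComplex.exact_of_g_is_cokernel _ (K.opcyclesIsCokernel _ _ (by simp))
  let φ : ShortComplex.mk (K.d (j + 1) j) (K.pOpcycles j) (K.d_pOpcycles _ _) ⟶
      opcyclesSequence K j :=
    ShortComplex.homMk (K.pOpcycles (j + 1)) (𝟙 (K.X j)) (𝟙 (K.opcycles j)) (by simp) (by simp)
  have : Epi φ.τ₁ := inferInstanceAs (Epi (K.pOpcycles (j + 1)))
  have : IsIso φ.τ₂ := inferInstanceAs (IsIso (𝟙 (K.X j)))
  have : Mono φ.τ₃ := inferInstanceAs (Mono (𝟙 (K.opcycles j)))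
  exact (ShortComplex.exact_iff_of_epi_of_isIso_of_mono φ).1 hT

lemma opcyclesSequence_shortExact {j : ℤ} (h : K.ExactAt (j + 1)) :
    (opcyclesSequence K j).ShortExact where
  exact := opcyclesSequence_exact K j
  mono_f := mono_fromOpcycles K h
  epi_g := inferInstanceAs (Epi (K.pOpcycles j))

variable {K}

lemma isZero_opcycles {j : ℤ} (h : IsZero (K.X j)) : IsZero (K.opcycles j) :=
  IsZero.of_epi (K.pOpcycles j) h

variable [HasExt.{w'} C] {X : C}

open Abelian

/-- In a complex ending on the left in degree `s`, exact in degrees above `h`, whose terms have no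
`Ext` from `X` in degrees below `g`, the cokernels inherit vanishing of `Ext`. -/
lemma subsingleton_ext_opcycles {s h : ℤ} {g : ℕ} (hs : ∀ j, s < j → IsZero (K.X j))
    (hE : ∀ j, h < j → K.ExactAt j)
    (hX : ∀ j, ∀ i < g, Subsingleton (Ext.{w'} X (K.X j) i)) (k : ℕ) :
    ∀ (j : ℤ), h ≤ j → j + k = s + 1 → ∀ i : ℕ, i + k ≤ g →
      Subsingleton (Ext.{w'} X (K.opcycles j) i) := by
  induction k with
  | zero =>
    intro j _ hj i _
    exact subsingleton_ext_of_isZero (isZero_opcycles (hs j (by lia))) i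
  | succ k ih =>
    intro j hhj hj i hi
    have h1 := ih (j + 1) (by lia) (by push_cast at hj; lia) (i + 1) (by lia)
    have h2 := hX j i (by lia)
    refine subsingleton_of_forall_eq 0 fun α => ?_
    obtain ⟨β, rfl⟩ := Ext.covariant_sequence_exact₃ X
      (opcyclesSequence_shortExact K (hE (j + 1) (by lia))) α rfl (h1.elim _ _)
    obtain rfl : β = 0 := h2.elim _ _
    exact Ext.zero_comp _ _ (Ext.mk₀ (opcyclesSequence K j).g) _ (add_zero i)

/-- The acyclicity lemma: under the hypotheses of `subsingleton_ext_opcycles` there are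
no nonzero maps from `X` to the homology in degrees close to the left end. -/
lemma hom_homology_eq_zero {s h : ℤ} {g : ℕ} (hs : ∀ j, s < j → IsZero (K.X j))
    (hE : ∀ j, h < j → K.ExactAt j)
    (hX : ∀ j, ∀ i < g, Subsingleton (Ext.{w'} X (K.X j) i)) (hsg : s < h + g)
    (f : X ⟶ K.homology h) : f = 0 := by
  have key : Subsingleton (Ext.{w'} X (K.opcycles h) 0) := by
    by_cases hsh : h ≤ s
    · exact subsingleton_ext_opcycles hs hE hX (s + 1 - h).toNat h le_rfl (by lia) 0 (by lia)
    · exact subsingleton_ext_of_isZero (isZero_opcycles (hs h (by lia))) 0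
  rw [← cancel_mono (K.homologyι h), zero_comp]
  exact subsingleton_ext_zero_iff.1 key _

/-- Dimension shifting down to m = 0, where exactness makes C_{j+1} → K_j mono. A class killed in
Ext^m(X, K_j) is the connecting image of some β in Ext^{m-1}(X, C_j); the image of β in Ext^{m-1}(X,
K_{j-1}) vanishes with that group, so β = 0 by induction. -/
lemma ext_opcycles_injective {t : ℤ} {i : ℕ} (hE : ∀ j, t < j → K.ExactAt j)
    (hX : ∀ j, ∀ i' < i, Subsingleton (Ext.{w'} X (K.X j) i')) (m : ℕ) :
    m ≤ i → ∀ j : ℤ, t + m ≤ j → ∀ α : Ext.{w'} X (K.opcycles (j + 1)) m,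
      α.comp (Ext.mk₀ (K.fromOpcycles (j + 1) j)) (add_zero m) = 0 → α = 0 := by
  induction m with
  | zero =>
    intro _ j hj α hα
    have := mono_fromOpcycles K (hE (j + 1) (by lia))
    exact Ext.postcomp_mk₀_injective_of_mono X (K.fromOpcycles (j + 1) j)
      (by simpa using hα)
  | succ m ih =>
    intro hm j hj α hα
    obtain ⟨β, rfl⟩ := Ext.covariant_sequence_exact₁ X
      (opcyclesSequence_shortExact K (hE (j + 1) (by lia))) α hα rfl
    obtain ⟨j, rfl⟩ : ∃ j', j = j' + 1 := ⟨j - 1, by lia⟩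
    have h2 := hX j m (by lia)
    obtain rfl : β = 0 := ih (by lia) j (by push_cast at hj; lia) β (h2.elim _ _)
    exact Ext.zero_comp _ _ (opcyclesSequence_shortExact K (hE (j + 1 + 1) (by lia))).extClass _ rfl

/-- If a complex ending on the left in degree `s + 1` is exact in degrees above `t` and its
last differential induces zero on `Ext`, then `Ext` into its last term vanishes in low degrees,
provided that all terms are built from the last one. -/
lemma subsingleton_ext_of_exactAt {s t : ℤ} (hs : IsZero (K.X (s + 1 + 1)))
    (hE : ∀ j, t < j → K.ExactAt j) (hadd : ∀ j, InAdd (K.X (s + 1)) (K.X j))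
    (hd : ∀ (i : ℕ) (α : Ext.{w'} X (K.X (s + 1)) i),
      α.comp (Ext.mk₀ (K.d (s + 1) s)) (add_zero i) = 0) (i : ℕ) (hi : t + i ≤ s) :
    Subsingleton (Ext.{w'} X (K.X (s + 1)) i) := by
  induction i using Nat.strong_induction_on with
  | _ i ih =>
    have hX : ∀ j, ∀ i' < i, Subsingleton (Ext.{w'} X (K.X j) i') := fun j i' hi' => by
      have := ih i' hi' (by lia)
      exact (hadd j).subsingleton_ext
    -- Nothing maps into K_{s+1}, so it is its own cokernel and `d` becomes the map whose effect on
    -- Ext is injective.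
    have : IsIso (K.pOpcycles (s + 1)) :=
      K.isIso_pOpcycles (s + 1 + 1) (s + 1) (by simp) (hs.eq_of_src _ _)
    refine subsingleton_of_forall_eq 0 fun α => ?_
    have h0 : α.comp (Ext.mk₀ (K.pOpcycles (s + 1))) (add_zero i) = 0 := by
      refine ext_opcycles_injective hE hX i le_rfl s hi _ ?_
      rw [Ext.comp_assoc_of_third_deg_zero, Ext.mk₀_comp_mk₀, K.p_fromOpcycles, hd]
    rw [← Ext.comp_mk₀_id α, ← IsIso.hom_inv_id (K.pOpcycles (s + 1)), ← Ext.mk₀_comp_mk₀,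
      ← Ext.comp_assoc_of_third_deg_zero, h0, Ext.zero_comp]

end Complex

section Smul

universe v w w'

variable {R : Type u} [CommRing R] {C : Type w} [Category.{v} C] [Abelian C] [Linear R C]
  [HasExt.{w'} C]

open Abelian

/-- A morphism which is a combination of morphisms with coefficients annihilating `X` induces
zero on `Ext` from `X`. -/
lemma ext_comp_eq_zero_of_smul {X Y Z : C} {n : ℕ} (r : Fin n → R) (f : Fin n → (Y ⟶ Z))
    (hr : ∀ k, r k • 𝟙 X = 0) {i : ℕ} (α : Ext.{w'} X Y i) :
    α.comp (Ext.mk₀ (∑ k, r k • f k)) (add_zero i) = 0 := by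
  rw [Ext.mk₀_sum, Ext.comp_sum]
  refine Finset.sum_eq_zero fun k _ => ?_
  rw [Ext.mk₀_smul, Ext.comp_smul, ← Ext.smul_comp]
  have : r k • α = 0 := by
    rw [← Ext.mk₀_id_comp (r k • α), Ext.comp_smul, ← Ext.smul_comp, ← Ext.mk₀_smul, hr,
      Ext.mk₀_zero, Ext.zero_comp]
  rw [this, Ext.zero_comp]

end Smul

end

/-! ### The Koszul complex: terms, differential, contracting homotopies -/

section

open MonoidalCategory

variable {R : Type u} [CommRing R]

lemma InAdd.of_finite_projective (N : Type u) [AddCommGroup N] [Module R N] [Module.Finite R N]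
    [Module.Projective R N] : InAdd (ModuleCat.of R R) (ModuleCat.of R N) := by
  obtain ⟨n, f, g, -, -, hfg⟩ := Module.Finite.exists_comp_eq_id_of_projective R N
  refine ⟨n, fun k => ModuleCat.ofHom (LinearMap.proj k ∘ₗ g),
    fun k => ModuleCat.ofHom (f ∘ₗ LinearMap.single R (fun _ => R) k), ?_⟩
  ext x
  have hx : f (g x) = x := LinearMap.congr_fun hfg x
  simp only [ModuleCat.hom_sum, LinearMap.sum_apply]
  simp [← map_sum, Finset.univ_sum_single, hx]

lemma InAdd.trans {C : Type*} [Category* C] [Preadditive C] {A B D : C} (h : InAdd A B)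
    (h' : InAdd B D) : InAdd A D := by
  obtain ⟨n, f, g, hfg⟩ := h
  obtain ⟨m, f', g', hfg'⟩ := h'
  refine ⟨m * n, fun k => f' (finProdFinEquiv.symm k).1 ≫ f (finProdFinEquiv.symm k).2,
    fun k => g (finProdFinEquiv.symm k).2 ≫ g' (finProdFinEquiv.symm k).1, ?_⟩
  rw [← finProdFinEquiv.sum_comp, Fintype.sum_prod_type, ← hfg']
  refine Finset.sum_congr rfl fun i _ => ?_
  calc _ = f' i ≫ (∑ k, f k ≫ g k) ≫ g' i := by
        simp [Preadditive.comp_sum, Preadditive.sum_comp]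
    _ = _ := by rw [hfg, Category.id_comp]

section Koszul

variable {e : ℕ} (x : Fin e → R)

lemma isZero_of_neg {j : ℤ} (hj : j < 0) : IsZero ((koszulComplex x).X j) := by
  obtain ⟨n, rfl⟩ := Int.eq_negSucc_of_lt_zero hj
  exact @ModuleCat.isZero_of_subsingleton _ _ _ (inferInstanceAs (Subsingleton (⊥ : Submodule R _)))

lemma koszulComplex_isZero {j : ℤ} (hj : (e : ℤ) < j) : IsZero ((koszulComplex x).X j) := by
  obtain ⟨n, rfl⟩ := Int.eq_ofNat_of_zero_le (show 0 ≤ j by lia)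
  have : IsEmpty (Set.powersetCard (Fin e) n) := ⟨fun s => by
    have h1 := s.2
    have h2 := Finset.card_le_univ s.1
    simp [Set.powersetCard] at h1 h2
    lia⟩
  have := ((Pi.basisFun R (Fin e)).exteriorPower n).repr.toEquiv.subsingleton
  exact @ModuleCat.isZero_of_subsingleton _ _ _ this

lemma koszulComplex_inAdd (j : ℤ) : InAdd (ModuleCat.of R R) ((koszulComplex x).X j) := by
  by_cases hj : j < 0
  · exact ⟨0, Fin.elim0, Fin.elim0, (isZero_of_neg x hj).eq_of_src _ _⟩
  · obtain ⟨n, rfl⟩ := Int.eq_ofNat_of_zero_le (show 0 ≤ j by lia)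
    exact @InAdd.of_finite_projective R _ (⋀[R]^n (Fin e → R)) _ _ exteriorPower.instFinite
      (@Module.Projective.of_free _ _ _ _ _ (exteriorPower.instFree R n))

/-- The top exterior power has a basis vector indexed by the full subset, whose coordinate splits
off R. This transfers Ext vanishing from the last term to R. -/
lemma inAdd_koszulComplex {j : ℤ} (hj : j = e) :
    InAdd ((koszulComplex x).X j) (ModuleCat.of R R) := by
  subst hj
  let s : Set.powersetCard (Fin e) e := ⟨Finset.univ, by simp [Set.powersetCard]⟩
  let b := (Pi.basisFun R (Fin e)).exteriorPower e
  refine InAdd.of_retract (A := ModuleCat.of R (⋀[R]^e (Fin e → R)))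
    (ModuleCat.ofHom (LinearMap.toSpanSingleton R _ (b s))) (ModuleCat.ofHom (b.coord s)) ?_
  ext
  simp

lemma koszulComplex_not_isZero [Nontrivial R] : ¬ IsZero ((koszulComplex x).X e) := fun h =>
  have := ModuleCat.subsingleton_of_isZero ((inAdd_koszulComplex x rfl).isZero h)
  not_subsingleton R this

lemma koszulComplex_d (j : ℤ) : (koszulComplex x).d (j + 1) j =
    ModuleCat.ofHom ((koszulD x).restrict (koszulD_mem x j)) := by
  unfold koszulComplex
  exact ChainComplex.of_d (fun i => ModuleCat.of R (koszulDegree R e i))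
    (fun i => ModuleCat.ofHom ((koszulD x).restrict (koszulD_mem x i))) j

/-- Contraction is linear in the functional. This displays the coefficients in I, which annihilate
Ext from R/I. -/
lemma koszulD_eq_sum (y : ExteriorAlgebra R (Fin e → R)) :
    koszulD x y = ∑ k, x k • koszulD (Pi.single k 1) y := by
  have : koszulFunctional x = ∑ k, x k • koszulFunctional (Pi.single k (1 : R)) := by
    refine LinearMap.pi_ext' fun i => LinearMap.ext_ring ?_
    simp [koszulFunctional, Fintype.linearCombination_apply, Pi.single_apply]
  simp only [koszulD]
  rw [this]
  simp

lemma ofHom_koszulD_eq_sum (j : ℤ) : ModuleCat.ofHom ((koszulD x).restrict (koszulD_mem x j)) =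
    ∑ k, x k • ModuleCat.ofHom
      ((koszulD (Pi.single k (1 : R))).restrict (koszulD_mem (Pi.single k (1 : R)) j)) := by
  refine ModuleCat.hom_ext (LinearMap.ext fun y => Subtype.ext ?_)
  rw [ModuleCat.hom_sum, LinearMap.sum_apply]
  refine (koszulD_eq_sum x y.1).trans ?_
  rw [AddSubmonoidClass.coe_finsetSum]
  rfl

lemma koszulComplex_d_eq_sum (j : ℤ) :
    ∃ f : Fin e → ((koszulComplex x).X (j + 1) ⟶ (koszulComplex x).X j),
      (koszulComplex x).d (j + 1) j = ∑ k, x k • f k :=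
  ⟨_, (koszulComplex_d x j).trans (ofHom_koszulD_eq_sum x j)⟩

lemma ι_mul_mem (v : Fin e → R) (j : ℤ) :
    ∀ y ∈ koszulDegree R e j, ExteriorAlgebra.ι R v * y ∈ koszulDegree R e (j + 1) := by
  intro y hy
  match j, hy with
  | Int.ofNat n, hy =>
    change _ ∈ ⋀[R]^(n + 1) (Fin e → R)
    change y ∈ ⋀[R]^n (Fin e → R) at hy
    have h := Submodule.mul_mem_mul (LinearMap.mem_range_self (ExteriorAlgebra.ι R) v) hy
    rwa [ExteriorAlgebra.exteriorPower, ← pow_succ'] at h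
  | Int.negSucc n, hy =>
    have h : y = 0 := (Submodule.mem_bot R).1 hy
    rw [h, mul_zero]
    exact Submodule.zero_mem _

/-- Left multiplication by `v` on the terms of the Koszul complex. -/
def koszulMul (v : Fin e → R) (j : ℤ) :
    (koszulComplex x).X j ⟶ (koszulComplex x).X (j + 1) :=
  ModuleCat.ofHom (((LinearMap.mulLeft R (ExteriorAlgebra.ι R v))).restrict (ι_mul_mem v j))

lemma koszulMul_homotopy (v : Fin e → R) (j : ℤ) :
    (koszulComplex x).d (j + 1) j ≫ koszulMul x v j +
      koszulMul x v (j + 1) ≫ (koszulComplex x).d (j + 1 + 1) (j + 1) =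
    koszulFunctional x v • 𝟙 ((koszulComplex x).X (j + 1)) := by
  rw [koszulComplex_d, koszulComplex_d]
  refine ModuleCat.hom_ext (LinearMap.ext fun y => Subtype.ext ?_)
  let z : koszulDegree R e (j + 1) := y
  change ExteriorAlgebra.ι R v * koszulD x z.1 + koszulD x (ExteriorAlgebra.ι R v * z.1) =
    koszulFunctional x v • z.1
  rw [koszulD_ι_mul]
  abel

/-- Exterior multiplication by v is a homotopy from multiplication by the value of the functional at
v to zero, and linear functors preserve it. With F the functor - ⊗ M, it follows that I kills the
homology of K ⊗ M. -/
lemma smul_homology_eq_zero {D : Type*} [Category* D] [Abelian D] [Linear R D]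
    (F : ModuleCat.{u} R ⥤ D) [F.Additive] [F.Linear R] (v : Fin e → R) (j : ℤ) :
    koszulFunctional x v •
      𝟙 (((F.mapHomologicalComplex _).obj (koszulComplex x)).homology j) = 0 := by
  let L := (F.mapHomologicalComplex (ComplexShape.down ℤ)).obj (koszulComplex x)
  let h : ∀ i j, (ComplexShape.down ℤ).Rel j i → (L.X i ⟶ L.X j) := fun i j hij => by
    obtain rfl : i + 1 = j := hij
    exact F.map (koszulMul x v i)
  have hf : koszulFunctional x v • 𝟙 L = Homotopy.nullHomotopicMap' h := by
    refine HomologicalComplex.hom_ext _ _ fun k => ?_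
    obtain ⟨k, rfl⟩ : ∃ k', k = k' + 1 := ⟨k - 1, by lia⟩
    rw [Homotopy.nullHomotopicMap'_f (k₂ := k + 1 + 1) (k₁ := k + 1) (k₀ := k) rfl rfl]
    change koszulFunctional x v • 𝟙 (F.obj _) =
      F.map ((koszulComplex x).d (k + 1) k) ≫ F.map (koszulMul x v k) +
      F.map (koszulMul x v (k + 1)) ≫ F.map ((koszulComplex x).d (k + 1 + 1) (k + 1))
    rw [← F.map_comp, ← F.map_comp, ← F.map_add, koszulMul_homotopy, F.map_smul, F.map_id]
  have h1 := (Homotopy.nullHomotopy' h).homologyMap_eq j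
  rw [← hf, HomologicalComplex.homologyMap_zero] at h1
  have h2 : ShortComplex.homologyMap (koszulFunctional x v • 𝟙 (L.sc j)) =
      koszulFunctional x v • 𝟙 (L.homology j) := by
    rw [ShortComplex.homologyMap_smul, ShortComplex.homologyMap_id]
    rfl
  exact h2.symm.trans h1

end Koszul

end

/-! ### Grade, exactness of K ⊗ M, and quasi-projective dimension -/

section

open MonoidalCategory

variable {R : Type u} [CommRing R]

section Grade

variable {I : Ideal R}

lemma subsingleton_ext_of_lt_grade {M : Type u} [AddCommGroup M] [Module R M] {i : ℕ}
    (hi : (i : ℕ∞) < grade I M) :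
    Subsingleton (Abelian.Ext.{u} (ModuleCat.of R (R ⧸ I)) (ModuleCat.of R M) i) := by
  by_contra h
  rw [not_subsingleton_iff_nontrivial] at h
  exact (not_le_of_gt hi) (sInf_le ⟨i, h, rfl⟩)

lemma le_grade {M : Type u} [AddCommGroup M] [Module R M] {g : ℕ}
    (h : ∀ i < g, Subsingleton (Abelian.Ext.{u} (ModuleCat.of R (R ⧸ I)) (ModuleCat.of R M) i)) :
    (g : ℕ∞) ≤ grade I M := by
  refine le_sInf ?_
  rintro _ ⟨i, hi, rfl⟩
  by_contra hlt
  exact not_subsingleton_iff_nontrivial.2 hi (h i (by exact_mod_cast not_le.1 hlt))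

lemma smul_id_quotient {r : R} (hr : r ∈ I) : r • 𝟙 (ModuleCat.of R (R ⧸ I)) = 0 := by
  ext
  change r • (Ideal.Quotient.mk I 1) = 0
  rw [← Ideal.Quotient.mk_eq_mk, ← Submodule.Quotient.mk_smul, smul_eq_mul, mul_one]
  exact (Submodule.Quotient.mk_eq_zero I).2 hr

/-- The Koszul complex with coefficients in `M`. -/
abbrev koszulTensor {e : ℕ} (x : Fin e → R) (M : Type u) [AddCommGroup M] [Module R M] :
    ChainComplex (ModuleCat.{u} R) ℤ :=
  ((tensorRight (ModuleCat.of R M)).mapHomologicalComplex (ComplexShape.down ℤ)).obj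
    (koszulComplex x)

section

variable {e : ℕ} {x : Fin e → R} {M : Type u} [AddCommGroup M] [Module R M]

lemma koszulTensor_isZero {j : ℤ} (hj : (e : ℤ) < j) : IsZero ((koszulTensor x M).X j) :=
  (tensorRight (ModuleCat.of R M)).map_isZero (koszulComplex_isZero x hj)

lemma tensorUnit_inAdd (M : ModuleCat.{u} R) :
    InAdd M ((tensorRight M).obj (ModuleCat.of R R)) :=
  InAdd.of_retract (λ_ M).hom (λ_ M).inv (λ_ M).hom_inv_id

lemma inAdd_tensorUnit (M : ModuleCat.{u} R) :
    InAdd ((tensorRight M).obj (ModuleCat.of R R)) M :=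
  InAdd.of_retract (λ_ M).inv (λ_ M).hom (λ_ M).inv_hom_id

lemma koszulTensor_inAdd (j : ℤ) : InAdd (ModuleCat.of R M) ((koszulTensor x M).X j) :=
  (tensorUnit_inAdd (ModuleCat.of R M)).trans ((koszulComplex_inAdd x j).map (tensorRight _))

lemma inAdd_koszulTensor {j : ℤ} (hj : j = e) :
    InAdd ((koszulTensor x M).X j) (ModuleCat.of R M) :=
  ((inAdd_koszulComplex x hj).map (tensorRight _)).trans (inAdd_tensorUnit (ModuleCat.of R M))

lemma koszulTensor_exactAt_of_flat [Module.Flat R M] {j : ℤ} (h : (koszulComplex x).ExactAt j) :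
    (koszulTensor x M).ExactAt j :=
  Module.Flat.rTensor_shortComplex_exact (ModuleCat.of R M) _ h

lemma subsingleton_ext_of_koszulTensor_exactAt (hx : ∀ k, x k ∈ I) {t : ℤ}
    (hE : ∀ j, t < j → (koszulTensor x M).ExactAt j) (i : ℕ) (hi : t + i < e) :
    Subsingleton (Abelian.Ext.{u} (ModuleCat.of R (R ⧸ I)) (ModuleCat.of R M) i) := by
  have he : (e : ℤ) - 1 + 1 = e := by ring
  have hadd := inAdd_koszulTensor (x := x) (M := M) he
  -- The last term sits in degree s + 1 = e.
  have := subsingleton_ext_of_exactAt (X := ModuleCat.of R (R ⧸ I)) (s := e - 1)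
    (koszulTensor_isZero (x := x) (M := M) (by lia)) hE
    (fun j => hadd.trans (koszulTensor_inAdd j)) ?_ i (by lia)
  · exact hadd.subsingleton_ext
  · intro i α
    obtain ⟨f, hf⟩ := koszulComplex_d_eq_sum x (e - 1)
    have hd : (koszulTensor x M).d ((e : ℤ) - 1 + 1) (e - 1) =
        ∑ k, x k • (tensorRight (ModuleCat.of R M)).map (f k) := by
      change (tensorRight (ModuleCat.of R M)).map ((koszulComplex x).d _ _) = _
      rw [hf, Functor.map_sum]
      simp only [Functor.map_smul]
    rw [hd]
    exact ext_comp_eq_zero_of_smul x _ (fun k => smul_id_quotient (hx k)) α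

/-- Since I kills H, every element of H is the image of 1 under some map from R/I. -/
lemma isZero_of_hom_quotient {H : ModuleCat.{u} R} (hI : ∀ r ∈ I, r • 𝟙 H = 0)
    (h : ∀ f : ModuleCat.of R (R ⧸ I) ⟶ H, f = 0) : IsZero H := by
  have : Subsingleton H := by
    refine subsingleton_of_forall_eq 0 fun z => ?_
    have hz : I ≤ LinearMap.ker (LinearMap.toSpanSingleton R H z) := fun r hr =>
      show r • z = 0 from congrArg (fun f => f.hom z) (hI r hr)
    have h1 : (1 : R) • z = 0 := congrArg (fun f => f.hom (Submodule.Quotient.mk 1))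
      (h (ModuleCat.ofHom (Submodule.liftQ I _ hz)))
    rwa [one_smul] at h1
  exact ModuleCat.isZero_of_subsingleton H

/-- Depth sensitivity, by descending induction on the degree (k bounds the distance from the top).
Once K ⊗ M is exact above j, the acyclicity lemma kills all maps from R/I to the homology at j, and
this homology is annihilated by I. -/
lemma koszulTensor_exactAt (hx : Ideal.span (Set.range x) = I) {g : ℕ}
    (hM : ∀ i < g, Subsingleton
      (Abelian.Ext.{u} (ModuleCat.of R (R ⧸ I)) (ModuleCat.of R M) i)) (k : ℕ) :
    ∀ j : ℤ, (e : ℤ) < j + k → (e : ℤ) < j + g → (koszulTensor x M).ExactAt j := by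
  induction k with
  | zero =>
    intro j hj _
    rw [HomologicalComplex.exactAt_iff_isZero_homology]
    exact ShortComplex.isZero_homology_of_isZero_X₂ _ (koszulTensor_isZero (by simpa using hj))
  | succ k ih =>
    intro j hj hjg
    rw [HomologicalComplex.exactAt_iff_isZero_homology]
    refine isZero_of_hom_quotient (I := I) (fun r hr => ?_) fun f => ?_
    · rw [← hx, Ideal.span, ← Fintype.range_linearCombination R x] at hr
      obtain ⟨v, rfl⟩ := hr
      exact smul_homology_eq_zero x (tensorRight (ModuleCat.of R M)) v j
    · refine hom_homology_eq_zero (s := e) (g := g) (fun i hi => koszulTensor_isZero hi)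
        (fun i hi => ih i (by push_cast at hj; lia) (by lia)) (fun i n hn => ?_) hjg f
      have := hM n hn
      exact (koszulTensor_inAdd i).subsingleton_ext

end

lemma IsQuasiProjectiveResolution.homology_inAdd {P : ChainComplex (ModuleCat.{u} R) ℤ}
    {M : Type u} [AddCommGroup M] [Module R M] (h : IsQuasiProjectiveResolution P M) (i : ℤ) :
    InAdd (ModuleCat.of R M) (P.homology i) := by
  obtain ⟨a, -, ha⟩ := h.homology
  obtain ⟨φ⟩ := ha i
  refine InAdd.retract (Y := ModuleCat.of R (Fin (a i) → M)) ?_ φ.hom φ.inv φ.hom_inv_id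
  refine ⟨a i, fun k => ModuleCat.ofHom (LinearMap.proj k),
    fun k => ModuleCat.ofHom (LinearMap.single R (fun _ => M) k), ?_⟩
  refine ModuleCat.hom_ext (LinearMap.ext fun y => ?_)
  simp only [ModuleCat.hom_sum, LinearMap.sum_apply]
  simp [Finset.univ_sum_single]

/-- The acyclicity lemma read contrapositively: a nonzero homology module in add(X) admits a nonzero
map from X. -/
lemma add_le_of_homology {X : ModuleCat.{u} R} {P : ChainComplex (ModuleCat.{u} R) ℤ} {s h : ℤ}
    {g : ℕ} (hs : ∀ j, s < j → IsZero (P.X j)) (hE : ∀ j, h < j → IsZero (P.homology j))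
    (hX : ∀ j, ∀ i < g, Subsingleton (Abelian.Ext.{u} X (P.X j) i))
    (hadd : InAdd X (P.homology h)) (hh : ¬ IsZero (P.homology h)) : h + g ≤ s := by
  by_contra hlt
  refine hh (hadd.isZero_of_hom fun f => ?_)
  exact hom_homology_eq_zero hs
    (fun j hj => (HomologicalComplex.exactAt_iff_isZero_homology _ _).2 (hE j hj)) hX (by lia) f

lemma qpd_eq_grade_and_grade_ne_top (hI : I ≠ ⊤) (hF : IsFKH I) :
    qpd R (R ⧸ I) = ((grade I R : ℕ∞) : WithBot ℕ∞) ∧ grade I R ≠ ⊤ := by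
  obtain ⟨e, x, hx, hQ⟩ := hF
  have hnt : Nontrivial (R ⧸ I) := Ideal.Quotient.nontrivial_iff.2 hI
  have : Nontrivial R := (Ideal.Quotient.mk I).domain_nontrivial
  have hxI : ∀ k, x k ∈ I := fun k => hx ▸ Ideal.subset_span ⟨k, rfl⟩
  have hzero : ∀ j : ℤ, (e : ℤ) < j → IsZero ((koszulComplex x).X j) :=
    fun j hj => koszulComplex_isZero x hj
  have hne : ∃ j, ¬ IsZero ((koszulComplex x).homology j) := by
    obtain ⟨a, ⟨j, hj⟩, ha⟩ := hQ.homology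
    obtain ⟨φ⟩ := ha j
    refine ⟨j, fun h0 => ?_⟩
    have hsub : Subsingleton (Fin (a j) → R ⧸ I) := ModuleCat.subsingleton_of_isZero (h0.of_iso φ.symm)
    have : Nonempty (Fin (a j)) := ⟨⟨0, Nat.pos_of_ne_zero hj⟩⟩
    exact not_subsingleton (Fin (a j) → R ⧸ I) hsub
  obtain ⟨h, hh, hmax⟩ := Int.exists_greatest_of_bdd ⟨(e : ℤ), fun j hj => by
    by_contra hlt
    exact hj (ShortComplex.isZero_homology_of_isZero_X₂ _ (hzero j (by lia)))⟩ hne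
  have hE : ∀ j, h < j → IsZero ((koszulComplex x).homology j) := fun j hj => by
    by_contra hn
    exact absurd (hmax j hn) (by lia)
  -- Needed for all projectives, not only for R: the terms of a competing resolution may be
  -- infinitely generated.
  have hExt (P : ModuleCat.{u} R) [Projective P] (i : ℕ) (hi : h + i < e) :
      Subsingleton (Abelian.Ext.{u} (ModuleCat.of R (R ⧸ I)) P i) := by
    have : Module.Projective R P := (IsProjective.iff_projective P).2 ‹_›
    exact subsingleton_ext_of_koszulTensor_exactAt (M := P) hxI (fun j hj =>
      koszulTensor_exactAt_of_flat
        ((HomologicalComplex.exactAt_iff_isZero_homology _ _).2 (hE j hj))) i hi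
  have hle (g : ℕ) (hg : ∀ i < g, Subsingleton
      (Abelian.Ext.{u} (ModuleCat.of R (R ⧸ I)) (ModuleCat.of R R) i)) : h + g ≤ e :=
    add_le_of_homology hzero hE (fun j i hi => by
      have := hg i hi
      exact (koszulComplex_inAdd x j).subsingleton_ext) (hQ.homology_inAdd h) hh
  obtain ⟨d, hd⟩ : ∃ d : ℕ, h + d = e := ⟨(e - h).toNat, by
    have := hle 0 (by simp)
    push_cast at this
    lia⟩
  have hR : Projective (ModuleCat.of R R) := (IsProjective.iff_projective R).1 inferInstance
  -- The bound ≥ is `hExt` for P = R. If the grade exceeded d, then `hle` at d + 1 would give h + d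
  -- + 1 ≤ e = h + d.
  have hgrade : grade I R = d := by
    refine le_antisymm ?_ (le_grade fun i hi => hExt _ i (by lia))
    by_contra hlt
    have := hle (d + 1) fun i hi => subsingleton_ext_of_lt_grade
      (lt_of_le_of_lt (by exact_mod_cast Nat.lt_succ_iff.1 hi) (not_le.1 hlt))
    push_cast at this
    lia
  refine ⟨?_, hgrade ▸ ENat.natCast_ne_top d⟩
  rw [qpd, if_neg (not_subsingleton _), hgrade]
  congr 1
  refine le_antisymm (sInf_le ⟨koszulComplex x, h, d, hQ, ⟨?_, ?_⟩, ⟨hh, ?_⟩, rfl⟩) (le_sInf ?_)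
  · rw [hd]; exact koszulComplex_not_isZero x
  · intro j hj
    by_contra hlt
    exact hj (hzero j (by lia))
  · exact fun j hj => hmax j hj
  · rintro _ ⟨P, h', d', hP, hs, hh', rfl⟩
    have := add_le_of_homology (X := ModuleCat.of R (R ⧸ I)) (P := P) (s := h' + d') (h := h')
      (g := d) (fun j hj => by
        by_contra hn
        exact absurd (hs.2 hn) (by lia))
      (fun j hj => by
        by_contra hn
        exact absurd (hh'.2 hn) (by lia))
      (fun j i hi => by
        have := hP.projective j
        exact hExt _ i (by lia)) (hP.homology_inAdd h') hh'.1
    exact_mod_cast (by lia : d ≤ d')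

end Grade

end

/-! ### Ungraded Koszul homology and change of generators -/

section

section

variable {C : Type*} [Category* C] [Preadditive C]

lemma InAdd.of_fintype {ι : Type*} [Fintype ι] {A Y : C} (a : ι → (Y ⟶ A)) (b : ι → (A ⟶ Y))
    (h : ∑ k, a k ≫ b k = 𝟙 Y) : InAdd A Y := by
  let φ := Fintype.equivFin ι
  refine ⟨Fintype.card ι, fun k => a (φ.symm k), fun k => b (φ.symm k), ?_⟩
  rw [← h, ← φ.symm.sum_comp]

lemma InAdd.of_sum {ι : Type*} [Fintype ι] {A Y : C} {Z : ι → C} (a : ∀ k, Y ⟶ Z k)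
    (b : ∀ k, Z k ⟶ Y) (h : ∑ k, a k ≫ b k = 𝟙 Y) (hZ : ∀ k, InAdd A (Z k)) : InAdd A Y := by
  choose n f g hfg using hZ
  refine InAdd.of_fintype (ι := Σ k, Fin (n k)) (fun k => a k.1 ≫ f k.1 k.2)
    (fun k => g k.1 k.2 ≫ b k.1) ?_
  rw [Fintype.sum_sigma, ← h]
  refine Finset.sum_congr rfl fun k _ => ?_
  calc _ = a k ≫ (∑ i, f k i ≫ g k i) ≫ b k := by
        simp [Preadditive.comp_sum, Preadditive.sum_comp]
    _ = _ := by rw [hfg, Category.id_comp]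

lemma inAdd_homology {D : Type*} [Category* D] [Abelian D] {ι : Type*} [Fintype ι] {A : D}
    {S : ShortComplex D} {T : ι → ShortComplex D} (a : ∀ k, S ⟶ T k) (b : ∀ k, T k ⟶ S)
    (h : ∑ k, a k ≫ b k = 𝟙 S) (hT : ∀ k, InAdd A (T k).homology) : InAdd A S.homology := by
  refine InAdd.of_sum (Y := (ShortComplex.homologyFunctor D).obj S)
    (Z := fun k => (ShortComplex.homologyFunctor D).obj (T k))
    (fun k => (ShortComplex.homologyFunctor D).map (a k))
    (fun k => (ShortComplex.homologyFunctor D).map (b k)) ?_ hT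
  simp only [← Functor.map_comp, ← Functor.map_sum, h]
  exact (ShortComplex.homologyFunctor D).map_id S

end

variable {R : Type u} [CommRing R]

section Contraction

variable {N N' : Type u} [AddCommGroup N] [Module R N] [AddCommGroup N'] [Module R N']

/-- Contraction with a functional, on the exterior algebra. -/
def contraction (f : Module.Dual R N) : ExteriorAlgebra R N →ₗ[R] ExteriorAlgebra R N :=
  CliffordAlgebra.contractLeft f

lemma contraction_ι_mul (f : Module.Dual R N) (v : N) (y : ExteriorAlgebra R N) :
    contraction f (ExteriorAlgebra.ι R v * y) = f v • y - ExteriorAlgebra.ι R v * contraction f y :=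
  CliffordAlgebra.contractLeft_ι_mul _ _ _

lemma contraction_algebraMap (f : Module.Dual R N) (r : R) :
    contraction f (algebraMap R _ r) = 0 :=
  CliffordAlgebra.contractLeft_algebraMap _ _ _

lemma contraction_contraction (f : Module.Dual R N) (y : ExteriorAlgebra R N) :
    contraction f (contraction f y) = 0 :=
  CliffordAlgebra.contractLeft_contractLeft _ _

lemma contraction_comm (f g : Module.Dual R N) (y : ExteriorAlgebra R N) :
    contraction f (contraction g y) = - contraction g (contraction f y) :=
  CliffordAlgebra.contractLeft_comm _ _ _

lemma contraction_map (i : N →ₗ[R] N') (f : Module.Dual R N') (y : ExteriorAlgebra R N) :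
    contraction f (ExteriorAlgebra.map i y) = ExteriorAlgebra.map i (contraction (f ∘ₗ i) y) := by
  induction y using CliffordAlgebra.left_induction with
  | algebraMap r =>
    change contraction f (ExteriorAlgebra.map i (algebraMap R (ExteriorAlgebra R N) r)) =
      ExteriorAlgebra.map i (contraction (f ∘ₗ i) (algebraMap R (ExteriorAlgebra R N) r))
    rw [AlgHom.commutes, contraction_algebraMap, contraction_algebraMap, map_zero]
  | add x y hx hy => rw [map_add, map_add, map_add, map_add, hx, hy]
  | ι_mul y v hy =>
    change contraction f (ExteriorAlgebra.map i (ExteriorAlgebra.ι R v * y)) =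
      ExteriorAlgebra.map i (contraction (f ∘ₗ i) (ExteriorAlgebra.ι R v * y))
    rw [map_mul, ExteriorAlgebra.map_apply_ι, contraction_ι_mul, contraction_ι_mul, map_sub,
      map_smul, map_mul, ExteriorAlgebra.map_apply_ι, hy, LinearMap.comp_apply]

/-- The ungraded Koszul complex of a functional, on the whole exterior algebra. -/
abbrev contractionComplex (f : Module.Dual R N) : ShortComplex (ModuleCat.{u} R) :=
  ShortComplex.mk (ModuleCat.ofHom (contraction f)) (ModuleCat.ofHom (contraction f))
    (ModuleCat.hom_ext (LinearMap.ext (contraction_contraction f)))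

/-- A map commuting with contractions induces a map of ungraded Koszul complexes. -/
def contractionComplexMap {f : Module.Dual R N} {f' : Module.Dual R N'}
    (a : ExteriorAlgebra R N →ₗ[R] ExteriorAlgebra R N')
    (h : ∀ y, contraction f' (a y) = a (contraction f y)) :
    contractionComplex f ⟶ contractionComplex f' :=
  ShortComplex.homMk (ModuleCat.ofHom a) (ModuleCat.ofHom a) (ModuleCat.ofHom a)
    (ModuleCat.hom_ext (LinearMap.ext h)) (ModuleCat.hom_ext (LinearMap.ext h))

/-- A map anticommuting with contractions induces a map of ungraded Koszul complexes. -/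
def contractionComplexAntiMap {f : Module.Dual R N} {f' : Module.Dual R N'}
    (a : ExteriorAlgebra R N →ₗ[R] ExteriorAlgebra R N')
    (h : ∀ y, contraction f' (a y) = - a (contraction f y)) :
    contractionComplex f ⟶ contractionComplex f' :=
  ShortComplex.homMk (ModuleCat.ofHom (-a)) (ModuleCat.ofHom a) (ModuleCat.ofHom (-a))
    (ModuleCat.hom_ext (LinearMap.ext fun y => by
      change contraction f' (- a y) = a (contraction f y); rw [map_neg, h, neg_neg]))
    (ModuleCat.hom_ext (LinearMap.ext h))

/-- A retraction of modules compatible with the functionals induces, by functoriality of the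
exterior algebra, a retraction of Koszul complexes. -/
lemma contraction_homology_inAdd_of_retract {A : ModuleCat.{u} R} {f : Module.Dual R N}
    {f' : Module.Dual R N'} (i : N →ₗ[R] N') (p : N' →ₗ[R] N) (hi : f' ∘ₗ i = f)
    (hp : f ∘ₗ p = f') (hpi : p ∘ₗ i = LinearMap.id) (h : InAdd A (contractionComplex f').homology) :
    InAdd A (contractionComplex f).homology := by
  refine inAdd_homology (ι := Unit)
    (fun _ => contractionComplexMap (ExteriorAlgebra.map i).toLinearMap
      fun y => by rw [← hi]; exact contraction_map i f' y)
    (fun _ => contractionComplexMap (ExteriorAlgebra.map p).toLinearMap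
      fun y => by rw [← hp]; exact contraction_map p f y) ?_ fun _ => h
  have key : ∀ y, ExteriorAlgebra.map p (ExteriorAlgebra.map i y) = y := fun y => by
    rw [← AlgHom.comp_apply, ExteriorAlgebra.map_comp_map, hpi, ExteriorAlgebra.map_id,
      AlgHom.id_apply]
  have key' := ModuleCat.hom_ext (LinearMap.ext key)
    (f := ModuleCat.ofHom ((ExteriorAlgebra.map p).toLinearMap ∘ₗ
      (ExteriorAlgebra.map i).toLinearMap)) (g := 𝟙 (ModuleCat.of R (ExteriorAlgebra R N)))
  rw [Fintype.sum_unique]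
  exact ShortComplex.hom_ext _ _ key' key' key'

/-- The decomposition Λ(N × R) = Λ(N) ⊕ ε Λ(N), with ε the new basis vector: contracting with the
last coordinate extracts the ε-component. -/
lemma map_inl_add_ι_mul (y : ExteriorAlgebra R (N × R)) :
    ExteriorAlgebra.map (LinearMap.inl R N R) (ExteriorAlgebra.map (LinearMap.fst R N R) y) +
      ExteriorAlgebra.ι R ((0 : N), (1 : R)) * ExteriorAlgebra.map (LinearMap.inl R N R)
        (ExteriorAlgebra.map (LinearMap.fst R N R) (contraction (LinearMap.snd R N R) y)) = y := by
  induction y using CliffordAlgebra.left_induction with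
  | algebraMap r =>
    change ExteriorAlgebra.map (LinearMap.inl R N R) (ExteriorAlgebra.map (LinearMap.fst R N R)
      (algebraMap R (ExteriorAlgebra R (N × R)) r)) +
      ExteriorAlgebra.ι R ((0 : N), (1 : R)) * ExteriorAlgebra.map (LinearMap.inl R N R)
        (ExteriorAlgebra.map (LinearMap.fst R N R) (contraction (LinearMap.snd R N R)
          (algebraMap R (ExteriorAlgebra R (N × R)) r))) = algebraMap R _ r
    rw [AlgHom.commutes, AlgHom.commutes, contraction_algebraMap, map_zero, map_zero, mul_zero,
      add_zero]
  | add x y hx hy =>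
    nth_rw 3 [← hx]
    nth_rw 3 [← hy]
    simp only [map_add, mul_add]
    abel
  | ι_mul y v hy =>
    obtain ⟨v, r⟩ := v
    change ExteriorAlgebra.map (LinearMap.inl R N R) (ExteriorAlgebra.map (LinearMap.fst R N R)
      (ExteriorAlgebra.ι R (v, r) * y)) +
      ExteriorAlgebra.ι R ((0 : N), (1 : R)) * ExteriorAlgebra.map (LinearMap.inl R N R)
        (ExteriorAlgebra.map (LinearMap.fst R N R) (contraction (LinearMap.snd R N R)
          (ExteriorAlgebra.ι R (v, r) * y))) = ExteriorAlgebra.ι R (v, r) * y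
    rw [contraction_ι_mul]
    conv_rhs => rw [← hy]
    have hv : ExteriorAlgebra.ι R (v, r) =
        ExteriorAlgebra.ι R (v, (0 : R)) + r • ExteriorAlgebra.ι R ((0 : N), (1 : R)) := by
      rw [← map_smul, ← map_add]; simp
    have hsq : ExteriorAlgebra.ι R ((0 : N), (1 : R)) * ExteriorAlgebra.ι R ((0 : N), (1 : R)) = 0 :=
      ExteriorAlgebra.ι_sq_zero _
    have hsw := eq_neg_of_add_eq_zero_left
      (ExteriorAlgebra.ι_add_mul_swap (R := R) (v, (0 : R)) ((0 : N), (1 : R)))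
    simp only [map_mul, map_sub, map_smul, ExteriorAlgebra.map_apply_ι, LinearMap.fst_apply,
      LinearMap.inl_apply, LinearMap.snd_apply]
    rw [hv]
    simp only [add_mul, mul_add, smul_mul_assoc, ← mul_assoc, hsq, hsw, mul_sub, mul_smul_comm,
      zero_mul, smul_zero, neg_mul]
    abel

/-- Adjoining a generator with value zero doubles the complex. On the ε-summand the differential
changes sign, hence the anticommuting maps; the signs on their outer components cancel in the
composite. -/
lemma contraction_homology_inAdd_prod {A : ModuleCat.{u} R} {f : Module.Dual R N}
    (h : InAdd A (contractionComplex f).homology) :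
    InAdd A (contractionComplex (f ∘ₗ LinearMap.fst R N R)).homology := by
  have hf : (f ∘ₗ LinearMap.fst R N R) ∘ₗ LinearMap.inl R N R = f := by
    ext; simp
  let ε : ExteriorAlgebra R (N × R) := ExteriorAlgebra.ι R ((0 : N), (1 : R))
  refine inAdd_homology (ι := Bool) (T := fun _ => contractionComplex f)
    (fun k => if k then contractionComplexMap (ExteriorAlgebra.map (LinearMap.fst R N R)).toLinearMap
      (fun y => contraction_map _ _ _) else
      contractionComplexAntiMap ((ExteriorAlgebra.map (LinearMap.fst R N R)).toLinearMap ∘ₗ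
        contraction (LinearMap.snd R N R)) (fun y => by
          change contraction f (ExteriorAlgebra.map _ _) = _
          rw [contraction_map, contraction_comm, map_neg]
          rfl))
    (fun k => if k then contractionComplexMap (ExteriorAlgebra.map (LinearMap.inl R N R)).toLinearMap
      (fun y => by
        change contraction _ (ExteriorAlgebra.map _ _) = _
        rw [contraction_map, hf]
        rfl) else
      contractionComplexAntiMap (LinearMap.mulLeft R ε ∘ₗ
        (ExteriorAlgebra.map (LinearMap.inl R N R)).toLinearMap) (fun y => by
          change contraction _ (ε * ExteriorAlgebra.map _ _) = - (ε * ExteriorAlgebra.map _ _)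
          rw [contraction_ι_mul, contraction_map, hf]
          simp [ε])) ?_ fun _ => h
  rw [Fintype.sum_bool]
  refine ShortComplex.hom_ext _ _ ?_ ?_ ?_
  · refine ModuleCat.hom_ext (LinearMap.ext fun y => ?_)
    refine Eq.trans ?_ (map_inl_add_ι_mul y)
    change _ + -(ε * ExteriorAlgebra.map _ (-(ExteriorAlgebra.map _ _))) = _
    rw [map_neg, mul_neg, neg_neg]
    rfl
  · exact ModuleCat.hom_ext (LinearMap.ext map_inl_add_ι_mul)
  · refine ModuleCat.hom_ext (LinearMap.ext fun y => ?_)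
    refine Eq.trans ?_ (map_inl_add_ι_mul y)
    change _ + -(ε * ExteriorAlgebra.map _ (-(ExteriorAlgebra.map _ _))) = _
    rw [map_neg, mul_neg, neg_neg]
    rfl

lemma contraction_homology_inAdd_prod_of_equiv {A : ModuleCat.{u} R} {f : Module.Dual R N}
    {N'' : Type u} [AddCommGroup N''] [Module R N''] (c : (R × N') ≃ₗ[R] N'')
    (h : InAdd A (contractionComplex (f ∘ₗ LinearMap.fst R N N')).homology) :
    InAdd A (contractionComplex (f ∘ₗ LinearMap.fst R N N'')).homology := by
  refine contraction_homology_inAdd_of_retract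
    (((LinearMap.fst R N N'').prod (LinearMap.snd R R N' ∘ₗ c.symm.toLinearMap ∘ₗ
      LinearMap.snd R N N'')).prod
        (LinearMap.fst R R N' ∘ₗ c.symm.toLinearMap ∘ₗ LinearMap.snd R N N''))
    ((LinearMap.fst R N N' ∘ₗ LinearMap.fst R (N × N') R).prod (c.toLinearMap ∘ₗ
      (LinearMap.snd R (N × N') R).prod (LinearMap.snd R N N' ∘ₗ LinearMap.fst R (N × N') R)))
    ?_ ?_ ?_ (contraction_homology_inAdd_prod h)
  · ext <;> simp
  · ext <;> simp
  · refine LinearMap.ext fun z => ?_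
    simp

lemma contraction_homology_inAdd_pi {A : ModuleCat.{u} R} {f : Module.Dual R N}
    (h : InAdd A (contractionComplex f).homology) (m : ℕ) :
    InAdd A (contractionComplex (f ∘ₗ LinearMap.fst R N (Fin m → R))).homology := by
  induction m with
  | zero =>
    exact contraction_homology_inAdd_of_retract (LinearMap.fst R N (Fin 0 → R))
      (LinearMap.inl R N (Fin 0 → R)) rfl (by ext; simp)
      (LinearMap.ext fun z => Prod.ext rfl (Subsingleton.elim _ _)) h
  | succ m ih =>
    exact contraction_homology_inAdd_prod_of_equiv (Fin.consLinearEquiv R fun _ => R) ih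

/-- The total Koszul homology on one generating system is a summand of sums of copies of
the total Koszul homology on another one. -/
lemma koszul_homology_inAdd_of_span_eq {A : ModuleCat.{u} R} {e m : ℕ} {x : Fin e → R}
    {y : Fin m → R} (hxy : Ideal.span (Set.range x) = Ideal.span (Set.range y))
    (h : InAdd A (contractionComplex (koszulFunctional x)).homology) :
    InAdd A (contractionComplex (koszulFunctional y)).homology := by
  have hlift : ∀ {e m : ℕ} {x : Fin e → R} {y : Fin m → R},
      Ideal.span (Set.range x) = Ideal.span (Set.range y) →
      ∃ a : (Fin m → R) →ₗ[R] (Fin e → R), koszulFunctional x ∘ₗ a = koszulFunctional y := by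
    intro e m x y hxy
    have hy : ∀ k, ∃ v, koszulFunctional x v = y k := fun k => by
      have : y k ∈ Ideal.span (Set.range x) := hxy ▸ Ideal.subset_span ⟨k, rfl⟩
      rwa [Ideal.span, ← Fintype.range_linearCombination R x] at this
    choose v hv using hy
    refine ⟨Fintype.linearCombination R v, LinearMap.pi_ext' fun k => LinearMap.ext_ring ?_⟩
    have h1 : koszulFunctional y (Pi.single k 1) = y k := by simp [koszulFunctional]
    have h2 : Fintype.linearCombination R v (Pi.single k 1) = v k := by simp
    simp only [LinearMap.comp_apply, LinearMap.single_apply]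
    rw [h1, h2, hv]
  obtain ⟨a, ha⟩ := hlift hxy
  obtain ⟨b, hb⟩ := hlift hxy.symm
  have ha' := LinearMap.congr_fun ha
  have hb' := LinearMap.congr_fun hb
  simp only [LinearMap.comp_apply] at ha' hb'
  refine contraction_homology_inAdd_of_retract
    -- Extend x by m zeros. The section is z ↦ (a z, z) and the retraction (u, w) ↦ b u + w - b (a
    -- w); the correction term makes both compatible with the functionals, since b carries y to x
    -- and a carries x to y.
    (f' := koszulFunctional x ∘ₗ LinearMap.fst R (Fin e → R) (Fin m → R))
    (a.prod LinearMap.id) (LinearMap.coprod b (LinearMap.id - b ∘ₗ a)) ?_ ?_ ?_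
    (contraction_homology_inAdd_pi h m)
  · exact ha
  · refine LinearMap.ext fun z => ?_
    simp [hb', ha']
  · refine LinearMap.ext fun z => ?_
    simp

end Contraction

end

/-! ### Graded pieces of Koszul homology inside the ungraded one -/

section

variable {R : Type u} [CommRing R] {e : ℕ}

/-- The projection of the exterior algebra onto its component of degree `q`. -/
def koszulProj : ∀ q : ℤ, ExteriorAlgebra R (Fin e → R) →ₗ[R] koszulDegree R e q
  | Int.ofNat n => DirectSum.component R ℕ (fun i => ⋀[R]^i (Fin e → R)) n ∘ₗ
      (DirectSum.decomposeLinearEquiv (fun i : ℕ => ⋀[R]^i (Fin e → R))).toLinearMap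
  | Int.negSucc _ => 0

lemma koszulProj_same {q : ℤ} {z : ExteriorAlgebra R (Fin e → R)} (hz : z ∈ koszulDegree R e q) :
    (koszulProj q z).1 = z := by
  match q, hz with
  | Int.ofNat n, hz => exact DirectSum.decompose_of_mem_same (fun i : ℕ => ⋀[R]^i (Fin e → R)) hz
  | Int.negSucc n, hz => exact ((Submodule.mem_bot R).1 hz).symm

lemma koszulProj_ne {m q : ℤ} (hmq : m ≠ q) {z : ExteriorAlgebra R (Fin e → R)}
    (hz : z ∈ koszulDegree R e m) : koszulProj q z = 0 := by
  match m, q, hmq, hz with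
  | Int.ofNat m, Int.ofNat q, hmq, hz =>
    exact Subtype.ext (DirectSum.decompose_of_mem_ne (fun i : ℕ => ⋀[R]^i (Fin e → R)) hz
      fun h => hmq (by rw [h]))
  | _, Int.negSucc _, _, _ => rfl
  | Int.negSucc n, Int.ofNat q, _, hz =>
    rw [(Submodule.mem_bot R).1 hz, map_zero]

lemma koszulDegree_induction {p : ExteriorAlgebra R (Fin e → R) → Prop}
    (hadd : ∀ y z, p y → p z → p (y + z)) (h0 : p 0)
    (hom : ∀ (m : ℤ) (z), 0 ≤ m → z ∈ koszulDegree R e m → p z) (z) : p z := by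
  induction z using DirectSum.Decomposition.inductionOn fun i : ℕ => ⋀[R]^i (Fin e → R) with
  | zero => exact h0
  | add y z hy hz => exact hadd y z hy hz
  | homogeneous z => exact hom _ _ (Int.natCast_nonneg _) z.2

lemma koszulD_koszulProj (x : Fin e → R) (q : ℤ) (z : ExteriorAlgebra R (Fin e → R)) :
    koszulD x (koszulProj (q + 1) z).1 = (koszulProj q (koszulD x z)).1 := by
  induction z using koszulDegree_induction with
  | hadd y z hy hz =>
    rw [map_add, map_add, map_add, Submodule.coe_add, Submodule.coe_add, map_add, hy, hz]
  | h0 => simp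
  | hom m z _ hz =>
    obtain ⟨m, rfl⟩ : ∃ m', m = m' + 1 := ⟨m - 1, by lia⟩
    have hdz := koszulD_mem x m z hz
    by_cases hm : m = q
    · subst hm
      rw [koszulProj_same hz, koszulProj_same hdz]
    · rw [koszulProj_ne (by lia) hz, koszulProj_ne hm hdz]
      simp

/-- The offset c is the position in a three-term piece ending in degree k - 2. Letting k - 2 run
from -2 to e makes each of the three positions pass through all degrees 0, …, e exactly once. -/
lemma sum_koszulProj (c : ℤ) (h1 : 0 ≤ c) (h2 : c ≤ 2) (z : ExteriorAlgebra R (Fin e → R)) :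
    ∑ k : Fin (e + 3), (koszulProj ((k : ℤ) - 2 + c) z).1 = z := by
  induction z using koszulDegree_induction with
  | hadd y z hy hz =>
    conv_rhs => rw [← hy, ← hz]
    simp [Finset.sum_add_distrib]
  | h0 => simp
  | hom m z hm hz =>
    by_cases hme : m ≤ e
    · have hlt : (m + 2 - c).toNat < e + 3 := by lia
      rw [Finset.sum_eq_single (⟨(m + 2 - c).toNat, hlt⟩ : Fin (e + 3))]
      · have h : (((⟨(m + 2 - c).toNat, hlt⟩ : Fin (e + 3)) : ℕ) : ℤ) - 2 + c = m := by
          simp only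
          lia
        rw [h, koszulProj_same hz]
      · intro k _ hk
        rw [koszulProj_ne _ hz]
        · rfl
        · intro h
          apply hk
          ext
          simp only
          lia
      · simp
    · have hsub := ModuleCat.subsingleton_of_isZero
        (koszulComplex_isZero (fun _ : Fin e => (0 : R)) (not_le.1 hme))
      have : (⟨z, hz⟩ : koszulDegree R e m) = 0 := @Subsingleton.elim _ hsub _ _
      obtain rfl : z = 0 := congrArg Subtype.val this
      simp

variable (x : Fin e → R)

/-- Three consecutive terms of the Koszul complex. -/
abbrev koszulShort (q : ℤ) : ShortComplex (ModuleCat.{u} R) :=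
  ShortComplex.mk
    (ModuleCat.ofHom ((koszulD x).restrict (koszulD_mem x (q + 1))))
    (ModuleCat.ofHom ((koszulD x).restrict (koszulD_mem x q)))
    (ModuleCat.hom_ext (LinearMap.ext fun y => Subtype.ext (koszulD_koszulD x y.1)))

lemma nonempty_koszulShort_homology_iso (q : ℤ) :
    Nonempty ((koszulComplex x).homology (q + 1) ≅ (koszulShort x q).homology) := by
  have h : (koszulComplex x).sc' (q + 1 + 1) (q + 1) q ≅ koszulShort x q :=
    ShortComplex.isoMk (Iso.refl _) (Iso.refl _) (Iso.refl _)
      ((Category.id_comp _).trans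
        ((koszulComplex_d x (q + 1)).symm.trans (Category.comp_id _).symm))
      ((Category.id_comp _).trans ((koszulComplex_d x q).symm.trans (Category.comp_id _).symm))
  exact ⟨ShortComplex.homologyMapIso
    ((koszulComplex x).isoSc' (q + 1 + 1) (q + 1) q (by simp) (by simp) ≪≫ h)⟩

/-- The inclusion of the Koszul complex in the exterior algebra. -/
def koszulShortι (q : ℤ) : koszulShort x q ⟶ contractionComplex (koszulFunctional x) :=
  ShortComplex.homMk (ModuleCat.ofHom (koszulDegree R e (q + 1 + 1)).subtype)
    (ModuleCat.ofHom (koszulDegree R e (q + 1)).subtype)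
    (ModuleCat.ofHom (koszulDegree R e q).subtype) rfl rfl

/-- The projection of the exterior algebra onto the Koszul complex. -/
def koszulShortπ (q : ℤ) : contractionComplex (koszulFunctional x) ⟶ koszulShort x q :=
  ShortComplex.homMk (ModuleCat.ofHom (koszulProj (q + 1 + 1))) (ModuleCat.ofHom (koszulProj (q + 1)))
    (ModuleCat.ofHom (koszulProj q))
    (ModuleCat.hom_ext (LinearMap.ext fun z => Subtype.ext (koszulD_koszulProj x (q + 1) z)))
    (ModuleCat.hom_ext (LinearMap.ext fun z => Subtype.ext (koszulD_koszulProj x q z)))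

lemma koszulShort_retract (q : ℤ) : koszulShortι x q ≫ koszulShortπ x q = 𝟙 _ := by
  refine ShortComplex.hom_ext _ _ ?_ ?_ ?_ <;>
  exact ModuleCat.hom_ext (LinearMap.ext fun z => Subtype.ext (koszulProj_same z.2))

lemma koszulShort_sum :
    ∑ k : Fin (e + 3), koszulShortπ x ((k : ℤ) - 2) ≫ koszulShortι x ((k : ℤ) - 2) = 𝟙 _ := by
  have key (f : Fin (e + 3) → (ModuleCat.of R (ExteriorAlgebra R (Fin e → R)) ⟶
      ModuleCat.of R (ExteriorAlgebra R (Fin e → R)))) (c : ℤ) (h1 : 0 ≤ c) (h2 : c ≤ 2)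
      (hf : ∀ k z, (f k).hom z = (koszulProj ((k : ℤ) - 2 + c) z).1) : ∑ k, f k = 𝟙 _ := by
    refine ModuleCat.hom_ext (LinearMap.ext fun z => ?_)
    rw [ModuleCat.hom_sum, LinearMap.sum_apply]
    refine (Finset.sum_congr rfl fun k _ => hf k z).trans (sum_koszulProj c h1 h2 z)
  let S := contractionComplex (koszulFunctional x)
  refine ShortComplex.hom_ext _ _ ?_ ?_ ?_
  · refine (map_sum (AddMonoidHom.mk' (fun φ : S ⟶ S => φ.τ₁) fun _ _ => rfl) _ _).trans ?_
    exact key _ 2 (by lia) (by lia) fun k z => by rw [show (k : ℤ) - 2 + 2 = k - 2 + 1 + 1 by ring]; rfl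
  · refine (map_sum (AddMonoidHom.mk' (fun φ : S ⟶ S => φ.τ₂) fun _ _ => rfl) _ _).trans ?_
    exact key _ 1 (by lia) (by lia) fun k z => rfl
  · refine (map_sum (AddMonoidHom.mk' (fun φ : S ⟶ S => φ.τ₃) fun _ _ => rfl) _ _).trans ?_
    exact key _ 0 (by lia) (by lia) fun k z => by rw [add_zero]; rfl

/-- Graded pieces for the given system assemble to its ungraded homology; this is compared with the
ungraded homology on x, of which the graded homology on x is a retract. -/
lemma koszulComplex_homology_inAdd {I : Ideal R} (hF : IsFKH I)
    (hx : Ideal.span (Set.range x) = I) (q : ℤ) :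
    InAdd (ModuleCat.of R (R ⧸ I)) ((koszulComplex x).homology q) := by
  obtain ⟨m, y, hy, hQ⟩ := hF
  have hyq (q : ℤ) : InAdd (ModuleCat.of R (R ⧸ I)) (koszulShort y q).homology := by
    obtain ⟨φ⟩ := nonempty_koszulShort_homology_iso y q
    exact (hQ.homology_inAdd (q + 1)).retract φ.inv φ.hom φ.inv_hom_id
  have htot := koszul_homology_inAdd_of_span_eq (hy.trans hx.symm)
    (inAdd_homology _ _ (koszulShort_sum y) fun k => hyq _)
  obtain ⟨q, rfl⟩ : ∃ q', q = q' + 1 := ⟨q - 1, by lia⟩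
  obtain ⟨φ⟩ := nonempty_koszulShort_homology_iso x q
  have h := inAdd_homology (ι := Unit) (fun _ => koszulShortι x q) (fun _ => koszulShortπ x q)
    (by rw [Fintype.sum_unique]; exact koszulShort_retract x q) (fun _ => htot)
  exact h.retract φ.hom φ.inv φ.hom_inv_id

end

/-! ### Tor vanishing as exactness of a tensored flat resolution -/

section

variable {R : Type u} [CommRing R]

open TensorProduct

/-- Exactness of `C ⊗ P` in the middle of `P₂ ⟶ P₁ ⟶ P₀ ⟶ Q` for a cokernel `C` of `f : A ⟶ B`,
deduced from exactness for `B` and, one place further to the right, for `A`. -/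
lemma exact_lTensor_of_exact {A B C P₂ P₁ P₀ Q : Type u} [AddCommGroup A] [Module R A]
    [AddCommGroup B] [Module R B] [AddCommGroup C] [Module R C] [AddCommGroup P₂] [Module R P₂]
    [AddCommGroup P₁] [Module R P₁] [AddCommGroup P₀] [Module R P₀] [AddCommGroup Q] [Module R Q]
    {f : A →ₗ[R] B} {p : B →ₗ[R] C} (hfp : Function.Exact f p) (hp : Function.Surjective p)
    {d₂ : P₂ →ₗ[R] P₁} {d₁ : P₁ →ₗ[R] P₀} {d₀ : P₀ →ₗ[R] Q} (h21 : d₁ ∘ₗ d₂ = 0)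
    (h10 : d₀ ∘ₗ d₁ = 0) (hA : Function.Exact (d₁.lTensor A) (d₀.lTensor A))
    (hf : Function.Injective (f.rTensor Q)) (hB : Function.Exact (d₂.lTensor B) (d₁.lTensor B)) :
    Function.Exact (d₂.lTensor C) (d₁.lTensor C) := by
  have comm {X Y S T : Type u} [AddCommGroup X] [Module R X] [AddCommGroup Y] [Module R Y]
      [AddCommGroup S] [Module R S] [AddCommGroup T] [Module R T] (a : X →ₗ[R] Y) (d : S →ₗ[R] T)
      (z : X ⊗[R] S) : a.rTensor T (d.lTensor X z) = d.lTensor Y (a.rTensor S z) := by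
    rw [← LinearMap.comp_apply, ← LinearMap.comp_apply, LinearMap.rTensor_comp_lTensor,
      LinearMap.lTensor_comp_rTensor]
  intro z
  constructor
  · intro hz
    obtain ⟨y, rfl⟩ := LinearMap.rTensor_surjective P₁ hp z
    rw [← comm] at hz
    obtain ⟨a, ha⟩ := (rTensor_exact P₀ hfp hp _).1 hz
    have h0 : d₀.lTensor A a = 0 := by
      apply hf
      rw [comm, ha, ← LinearMap.comp_apply, ← LinearMap.lTensor_comp, h10, map_zero]
      simp
    obtain ⟨a', rfl⟩ := (hA _).1 h0
    -- Correcting the lift y by an element from A leaves its image in C ⊗ P₁ unchanged and makes it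
    -- a cycle.
    have hy : d₁.lTensor B (y - f.rTensor P₁ a') = 0 := by
      rw [map_sub, ← comm, ha, sub_self]
    obtain ⟨w, hw⟩ := (hB _).1 hy
    refine ⟨p.rTensor P₂ w, ?_⟩
    rw [← comm, hw, map_sub, sub_eq_self]
    exact (rTensor_exact P₁ hfp hp).apply_apply_eq_zero a'
  · rintro ⟨w, rfl⟩
    rw [← LinearMap.comp_apply, ← LinearMap.lTensor_comp, h21]
    simp

section Resolution

variable (R) in
/-- An exact complex `⋯ ⟶ X 2 ⟶ X 1 ⟶ X 0 ⟶ 0` with `X (k + 1)` flat, that is a flat resolution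
of `X 0` including the augmentation. -/
structure AugmentedResolution where
  X : ℕ → ModuleCat.{u} R
  d : ∀ k, X (k + 1) ⟶ X k
  flat : ∀ k, Module.Flat R (X (k + 1))
  surj : Function.Surjective (d 0).hom
  exact : ∀ k, Function.Exact (d (k + 1)).hom (d k).hom

variable (L : AugmentedResolution.{u} R)

/-- Exactness of `N ⊗ L` at the `i`-th term of the resolution. -/
def AugmentedResolution.TensorExact (N : Type u) [AddCommGroup N] [Module R N] (i : ℕ) : Prop :=
  Function.Exact ((L.d (i + 1)).hom.lTensor N) ((L.d i).hom.lTensor N)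

variable {L}

lemma AugmentedResolution.comp_eq_zero (k : ℕ) : (L.d k).hom ∘ₗ (L.d (k + 1)).hom = 0 :=
  (L.exact k).linearMap_comp_eq_zero

lemma AugmentedResolution.tensorExact_zero (N : Type u) [AddCommGroup N] [Module R N] :
    L.TensorExact N 0 :=
  lTensor_exact N (L.exact 0) L.surj

lemma AugmentedResolution.tensorExact_of_flat (N : Type u) [AddCommGroup N] [Module R N]
    [Module.Flat R N] (i : ℕ) : L.TensorExact N i :=
  Module.Flat.lTensor_exact N (L.exact i)

lemma AugmentedResolution.tensorExact_of_subsingleton (N : Type u) [AddCommGroup N] [Module R N]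
    [Subsingleton N] (i : ℕ) : L.TensorExact N i := by
  intro z
  exact ⟨fun _ => ⟨0, Subsingleton.elim _ _⟩, fun _ => Subsingleton.elim _ _⟩

lemma AugmentedResolution.TensorExact.of_inAdd {A N : ModuleCat.{u} R} (h : InAdd A N) {i : ℕ}
    (hA : L.TensorExact A i) : L.TensorExact N i := by
  obtain ⟨n, a, b, hab⟩ := h
  have comm {X Y S T : ModuleCat.{u} R} (a : X ⟶ Y) (d : S ⟶ T) (z : X ⊗[R] S) :
      a.hom.rTensor T (d.hom.lTensor X z) = d.hom.lTensor Y (a.hom.rTensor S z) := by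
    rw [← LinearMap.comp_apply, ← LinearMap.comp_apply, LinearMap.rTensor_comp_lTensor,
      LinearMap.lTensor_comp_rTensor]
  intro z
  constructor
  · intro hz
    have hk : ∀ k, ∃ w, (L.d (i + 1)).hom.lTensor A w = (a k).hom.rTensor _ z := fun k =>
      (hA _).1 (by rw [← comm, hz, map_zero])
    choose w hw using hk
    refine ⟨∑ k, (b k).hom.rTensor _ (w k), ?_⟩
    rw [map_sum]
    have hid := congrArg (fun f => f.hom.rTensor (L.X (i + 1)) z) hab
    simp only [ModuleCat.hom_sum, ModuleCat.hom_comp, ModuleCat.hom_id, LinearMap.rTensor_id,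
      LinearMap.id_apply] at hid
    rw [← LinearMap.coe_rTensorHom, map_sum, LinearMap.sum_apply] at hid
    refine Eq.trans (Finset.sum_congr rfl fun k _ => ?_) hid
    rw [← comm, hw, LinearMap.coe_rTensorHom, LinearMap.rTensor_comp, LinearMap.comp_apply]
  · rintro ⟨w, rfl⟩
    rw [← LinearMap.comp_apply, ← LinearMap.lTensor_comp, L.comp_eq_zero]
    simp

/-- The step of dimension shifting along `C' ⟶ K ⟶ C ⟶ 0` with `K` flat and `H ⟶ C'` the kernel of
the first map. -/
lemma AugmentedResolution.tensorExact_succ {H C' K C : Type u} [AddCommGroup H] [Module R H]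
    [AddCommGroup C'] [Module R C'] [AddCommGroup K] [Module R K] [Module.Flat R K]
    [AddCommGroup C] [Module R C] {h : H →ₗ[R] C'} {f : C' →ₗ[R] K} {p : K →ₗ[R] C}
    (hhf : Function.Exact h f) (hfp : Function.Exact f p)
    (hp : Function.Surjective p) (i : ℕ) (hH : L.TensorExact H i)
    (hinj : Function.Injective (h.rTensor (L.X i))) (hC' : L.TensorExact C' (i + 1)) :
    L.TensorExact C (i + 2) := by
  have h1 : Function.Exact h f.rangeRestrict := fun z => by
    rw [← hhf z, ← LinearMap.mem_ker, LinearMap.ker_rangeRestrict, LinearMap.mem_ker]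
  -- Split at the image B of f: first 0 → H → C' → B → 0 with H made into a kernel by `h1`, up to
  -- injectivity of h, then 0 → B → K → C → 0. In the second step flatness of K supplies the
  -- vanishing.
  have h2 : L.TensorExact (LinearMap.range f) (i + 1) :=
    exact_lTensor_of_exact h1 f.surjective_rangeRestrict (L.comp_eq_zero _) (L.comp_eq_zero _)
      hH hinj hC'
  have h3 : Function.Exact (LinearMap.range f).subtype p := fun z => by
    rw [hfp z]; simp
  have := L.flat i
  exact exact_lTensor_of_exact h3 hp (L.comp_eq_zero _) (L.comp_eq_zero _) h2
    (Module.Flat.rTensor_preserves_injective_linearMap _ (Submodule.injective_subtype _))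
    (L.tensorExact_of_flat K _)

/-- Tor_1(C, L.X 0) is the kernel of (image of d) ⊗ L.X 0 → K ⊗ L.X 0; exactness of the tensored
complex at K' says that this kernel is zero. -/
lemma AugmentedResolution.tensorExact_one {K' K'' K C : Type u} [AddCommGroup K'] [Module R K']
    [AddCommGroup K''] [Module R K''] [AddCommGroup K] [Module R K] [Module.Flat R K]
    [AddCommGroup C] [Module R C] {d' : K'' →ₗ[R] K'} {d : K' →ₗ[R] K} {p : K →ₗ[R] C}
    (hdd : d ∘ₗ d' = 0) (hd : Function.Exact d p) (hp : Function.Surjective p)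
    (hex : Function.Exact (d'.rTensor (L.X 0)) (d.rTensor (L.X 0))) :
    L.TensorExact C 1 := by
  have h3 : Function.Exact (LinearMap.range d).subtype p := fun z => by
    rw [hd z]; simp
  refine exact_lTensor_of_exact h3 hp (L.comp_eq_zero _) (L.comp_eq_zero _)
    (L.tensorExact_zero _) ?_ (L.tensorExact_of_flat K _)
  rw [injective_iff_map_eq_zero]
  intro z hz
  obtain ⟨y, rfl⟩ := LinearMap.rTensor_surjective (L.X 0) d.surjective_rangeRestrict z
  rw [← LinearMap.comp_apply, ← LinearMap.rTensor_comp] at hz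
  obtain ⟨w, rfl⟩ := (hex y).1 hz
  rw [← LinearMap.comp_apply, ← LinearMap.rTensor_comp]
  have : d.rangeRestrict ∘ₗ d' = 0 := LinearMap.ext fun z =>
    Subtype.ext (LinearMap.congr_fun hdd z)
  rw [this]
  simp

variable {M : Type u} [AddCommGroup M] [Module R M]

/-- The augmented resolution given by a projective resolution. -/
def augmentedResolution (P : ProjectiveResolution (ModuleCat.of R M)) :
    AugmentedResolution.{u} R where
  X k := match k with
    | 0 => ModuleCat.of R M
    | k + 1 => P.complex.X k
  d k := match k with
    | 0 => P.π.f 0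
    | k + 1 => P.complex.d (k + 1) k
  flat k := by
    have := P.projective k
    have : Module.Projective R (P.complex.X k) := (IsProjective.iff_projective _).2 this
    exact inferInstanceAs (Module.Flat R (P.complex.X k))
  surj := (ModuleCat.epi_iff_surjective (P.π.f 0)).1 inferInstance
  exact k := match k with
    | 0 => (ShortComplex.ShortExact.moduleCat_exact_iff_function_exact _).1
        (ShortComplex.exact_of_g_is_cokernel
          (ShortComplex.mk (P.complex.d 1 0) (P.π.f 0) P.complex_d_comp_π_f_zero)
          P.isColimitCokernelCofork)
    | k + 1 => (ShortComplex.ShortExact.moduleCat_exact_iff_function_exact _).1 (P.exact_succ k)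

lemma tensorExact_iff_isZero_tor (P : ProjectiveResolution (ModuleCat.of R M))
    (N : Type u) [AddCommGroup N] [Module R N] (i : ℕ) (hi : 1 ≤ i) :
    (augmentedResolution P).TensorExact N i ↔
      IsZero (((Tor (ModuleCat.{u} R) i).obj (ModuleCat.of R N)).obj (ModuleCat.of R M)) := by
  obtain ⟨i, rfl⟩ : ∃ j, i = j + 1 := ⟨i - 1, by lia⟩
  change _ ↔ IsZero ((((MonoidalCategory.tensoringLeft (ModuleCat.{u} R)).obj
    (ModuleCat.of R N)).leftDerived (i + 1)).obj (ModuleCat.of R M))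
  rw [(P.isoLeftDerivedObj ((MonoidalCategory.tensoringLeft (ModuleCat.{u} R)).obj
    (ModuleCat.of R N)) (i + 1)).isZero_iff]
  change _ ↔ IsZero (HomologicalComplex.homology _ (i + 1))
  rw [← HomologicalComplex.exactAt_iff_isZero_homology,
    HomologicalComplex.exactAt_iff' _ (i + 1 + 1) (i + 1) i (by simp) (by simp),
    ShortComplex.ShortExact.moduleCat_exact_iff_function_exact]
  rfl

end Resolution

end

/-! ### Rigidity of Tor by shifting along the Koszul complex -/

section

open MonoidalCategory

variable {R : Type u} [CommRing R] {I : Ideal R} {e : ℕ} {x : Fin e → R}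

/-- The same descending induction as for K ⊗ M, but membership in add(R/I) is what detects nonzero
homology. -/
lemma koszulComplex_isZero_homology {g : ℕ}
    (hR : ∀ i < g, Subsingleton
      (Abelian.Ext.{u} (ModuleCat.of R (R ⧸ I)) (ModuleCat.of R R) i))
    (hadd : ∀ j, InAdd (ModuleCat.of R (R ⧸ I)) ((koszulComplex x).homology j)) (k : ℕ) :
    ∀ j : ℤ, (e : ℤ) < j + k → (e : ℤ) < j + g → IsZero ((koszulComplex x).homology j) := by
  induction k with
  | zero =>
    intro j hj _
    exact ShortComplex.isZero_homology_of_isZero_X₂ _ (koszulComplex_isZero x (by simpa using hj))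
  | succ k ih =>
    intro j hj hjg
    refine (hadd j).isZero_of_hom fun f => ?_
    refine hom_homology_eq_zero (s := e) (g := g) (fun i hi => koszulComplex_isZero x hi)
      (fun i hi => (HomologicalComplex.exactAt_iff_isZero_homology _ _).2
        (ih i (by push_cast at hj; lia) (by lia))) (fun i n hn => ?_) hjg f
    have := hR n hn
    exact (koszulComplex_inAdd x i).subsingleton_ext

lemma one_mem_koszulDegree : (1 : ExteriorAlgebra R (Fin e → R)) ∈ koszulDegree R e 0 := by
  change _ ∈ ⋀[R]^0 (Fin e → R)
  rw [ExteriorAlgebra.exteriorPower, pow_zero]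
  exact Submodule.one_le.1 le_rfl

/-- The zeroth cokernel of the Koszul complex has `R ⧸ I` as a summand. -/
lemma opcycles_zero_inAdd (hx : Ideal.span (Set.range x) = I) :
    InAdd ((koszulComplex x).opcycles 0) (ModuleCat.of R (R ⧸ I)) := by
  let K := koszulComplex x
  let one : K.X 0 := (⟨1, one_mem_koszulDegree⟩ : koszulDegree R e 0)
  have hd : (koszulComplex x).d 1 0 =
      ModuleCat.ofHom ((koszulD x).restrict (koszulD_mem x 0)) := koszulComplex_d x 0
  let a₀ : R →ₗ[R] K.opcycles 0 := LinearMap.toSpanSingleton R _ ((K.pOpcycles 0).hom one)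
  have ha : I ≤ LinearMap.ker a₀ := by
    intro r hr
    rw [← hx, Ideal.span, ← Fintype.range_linearCombination R x] at hr
    obtain ⟨v, rfl⟩ := hr
    have hv : ExteriorAlgebra.ι R v ∈ koszulDegree R e 1 := by
      simpa using ι_mul_mem v 0 1 one_mem_koszulDegree
    let w : K.X 1 := (⟨_, hv⟩ : koszulDegree R e 1)
    have h1 : (K.d 1 0).hom w = koszulFunctional x v • one := by
      change ((koszulComplex x).d 1 0).hom w = _
      rw [hd]
      refine Subtype.ext ?_
      change koszulD x (ExteriorAlgebra.ι R v) = koszulFunctional x v • 1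
      rw [← mul_one (ExteriorAlgebra.ι R v), koszulD_ι_mul,
        koszulD_eq_zero_of_mem x one_mem_koszulDegree, mul_zero, sub_zero]
    change koszulFunctional x v • (K.pOpcycles 0).hom one = 0
    rw [← map_smul, ← h1]
    exact congrArg (fun f => f.hom w) (K.d_pOpcycles 1 0)
  let b₀ : K.X 0 ⟶ ModuleCat.of R (R ⧸ I) := ModuleCat.ofHom
    (Submodule.mkQ I ∘ₗ ExteriorAlgebra.algebraMapInv.toLinearMap ∘ₗ (koszulDegree R e 0).subtype)
  have hb : K.d 1 0 ≫ b₀ = 0 := by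
    change (koszulComplex x).d 1 0 ≫ b₀ = 0
    rw [hd]
    refine ModuleCat.hom_ext (LinearMap.ext fun z => ?_)
    obtain ⟨z, hz⟩ := z
    change z ∈ ⋀[R]^1 (Fin e → R) at hz
    rw [ExteriorAlgebra.exteriorPower, pow_one] at hz
    obtain ⟨v, rfl⟩ := hz
    change (Submodule.Quotient.mk (ExteriorAlgebra.algebraMapInv
      (koszulD x (ExteriorAlgebra.ι R v))) : R ⧸ I) = 0
    rw [← mul_one (ExteriorAlgebra.ι R v), koszulD_ι_mul,
      koszulD_eq_zero_of_mem x one_mem_koszulDegree, mul_zero, sub_zero, map_smul, map_one,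
      smul_eq_mul, mul_one, Submodule.Quotient.mk_eq_zero, ← hx, Ideal.span,
      ← Fintype.range_linearCombination R x]
    exact ⟨v, rfl⟩
  refine InAdd.of_retract (ModuleCat.ofHom (Submodule.liftQ I a₀ ha))
    (K.descOpcycles b₀ 1 (by simp) hb) ?_
  refine ModuleCat.hom_ext (Submodule.linearMap_qext _ (LinearMap.ext_ring ?_))
  change (K.descOpcycles b₀ 1 _ hb).hom ((1 : R) • (K.pOpcycles 0).hom one) =
    Submodule.Quotient.mk 1
  rw [one_smul]
  refine (congrArg (fun f => f.hom one) (K.p_descOpcycles b₀ 1 (by simp) hb)).trans ?_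
  change (Submodule.Quotient.mk (ExteriorAlgebra.algebraMapInv 1) : R ⧸ I) = _
  rw [map_one]

lemma koszulComplex_flat (j : ℤ) : Module.Flat R ((koszulComplex x).X j) := by
  by_cases hj : j < 0
  · have := ModuleCat.subsingleton_of_isZero (isZero_of_neg x hj)
    infer_instance
  · obtain ⟨n, rfl⟩ := Int.eq_ofNat_of_zero_le (show 0 ≤ j by lia)
    exact @Module.Flat.of_free R (⋀[R]^n (Fin e → R)) _ _ _ (exteriorPower.instFree R n)

section Shift

variable {L : AugmentedResolution.{u} R} {K : ChainComplex (ModuleCat.{u} R) ℤ}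

lemma pOpcycles_surjective (j : ℤ) : Function.Surjective (K.pOpcycles j).hom :=
  (ModuleCat.epi_iff_surjective _).1 inferInstance

lemma exact_fromOpcycles_pOpcycles (j : ℤ) :
    Function.Exact (K.fromOpcycles (j + 1) j).hom (K.pOpcycles j).hom :=
  (ShortComplex.ShortExact.moduleCat_exact_iff_function_exact _).1 (opcyclesSequence_exact K j)

lemma exact_homologyι_fromOpcycles (j : ℤ) :
    Function.Exact (K.homologyι (j + 1)).hom (K.fromOpcycles (j + 1) j).hom :=
  (ShortComplex.ShortExact.moduleCat_exact_iff_function_exact _).1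
    (ShortComplex.exact_of_f_is_kernel
      (ShortComplex.mk _ _ (K.homologyι_comp_fromOpcycles (j + 1) j))
      (K.homologyIsKernel (j + 1) j (by simp)))

lemma exact_d_pOpcycles (j : ℤ) :
    Function.Exact (K.d (j + 1) j).hom (K.pOpcycles j).hom :=
  (ShortComplex.ShortExact.moduleCat_exact_iff_function_exact _).1
    (ShortComplex.exact_of_g_is_cokernel
      (ShortComplex.mk _ _ (K.d_pOpcycles (j + 1) j)) (K.opcyclesIsCokernel _ _ (by simp)))

/-- Dimension shifting along a complex of flat modules: the `m`-th exactness for the zeroth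
cokernel, deduced from vanishing conditions on the homology and exactness of `K ⊗ L.X 0`. -/
lemma tensorExact_opcycles (hflat : ∀ j, Module.Flat R (K.X j)) {m : ℕ}
    (hH : ∀ q i : ℕ, q + i + 2 = m → IsZero (K.homology ((q : ℤ) + 1)) ∨
      (1 ≤ i ∧ L.TensorExact (K.homology ((q : ℤ) + 1)) i))
    (hK : ∀ q : ℤ, q + 1 = m → Function.Exact ((K.d (q + 1 + 1) (q + 1)).hom.rTensor (L.X 0))
      ((K.d (q + 1) q).hom.rTensor (L.X 0))) (i : ℕ) :
    ∀ q : ℕ, q + (i + 1) = m → L.TensorExact (K.opcycles q) (i + 1) := by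
  induction i with
  | zero =>
    intro q hq
    have := hflat q
    refine L.tensorExact_one (d' := (K.d ((q : ℤ) + 1 + 1) (q + 1)).hom) ?_
      (exact_d_pOpcycles (K := K) q) (pOpcycles_surjective (q : ℤ)) (hK q (by exact_mod_cast hq))
    rw [← ModuleCat.hom_comp, K.d_comp_d]
    rfl
  | succ i ih =>
    intro q hq
    have := hflat q
    have hC : L.TensorExact (K.opcycles ((q : ℤ) + 1)) (i + 1) := by
      have := ih (q + 1) (by lia)
      rwa [Nat.cast_add, Nat.cast_one] at this
    have h12 : L.TensorExact (K.homology ((q : ℤ) + 1)) i ∧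
        Function.Injective ((K.homologyι ((q : ℤ) + 1)).hom.rTensor (L.X i)) := by
      -- For i ≥ 1 the module `L.X i` is flat, so the inclusion of the homology stays injective. For
      -- i = 0 it is the resolved module itself, and the homology has to vanish.
      rcases hH q i (by lia) with h0 | ⟨hi, hE⟩
      · have := ModuleCat.subsingleton_of_isZero h0
        exact ⟨L.tensorExact_of_subsingleton _ i, Function.injective_of_subsingleton _⟩
      · obtain ⟨i, rfl⟩ : ∃ i', i = i' + 1 := ⟨i - 1, by lia⟩
        have := L.flat i
        exact ⟨hE, Module.Flat.rTensor_preserves_injective_linearMap _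
          ((ModuleCat.mono_iff_injective _).1 inferInstance)⟩
    exact L.tensorExact_succ (exact_homologyι_fromOpcycles (K := K) q)
      (exact_fromOpcycles_pOpcycles (K := K) q) (pOpcycles_surjective (q : ℤ)) i h12.1 h12.2 hC

end Shift

lemma isZero_tor_of_isZero_tor (hF : IsFKH I) (hx : Ideal.span (Set.range x) = I) (M : Type u)
    [AddCommGroup M] [Module R M] {n g : ℕ} (hn : 1 ≤ n)
    (hgR : (g : ℕ∞) ≤ grade I R) (hgM : (g : ℕ∞) ≤ grade I M)
    (hT : ∀ i : ℕ, n ≤ i → i + g ≤ e + n →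
      IsZero (((Tor (ModuleCat.{u} R) i).obj (ModuleCat.of R (R ⧸ I))).obj (ModuleCat.of R M)))
    (m : ℕ) (hm : n ≤ m) :
    IsZero (((Tor (ModuleCat.{u} R) m).obj (ModuleCat.of R (R ⧸ I))).obj (ModuleCat.of R M)) := by
  induction m using Nat.strong_induction_on with
  | _ m ih =>
  by_cases hmg : m + g ≤ e + n
  · exact hT m hm hmg
  · let P := ProjectiveResolution.of (ModuleCat.of R M)
    rw [← tensorExact_iff_isZero_tor P _ _ (by lia)]
    have hRext : ∀ i < g, Subsingleton
        (Abelian.Ext.{u} (ModuleCat.of R (R ⧸ I)) (ModuleCat.of R R) i) := fun i hi =>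
      subsingleton_ext_of_lt_grade (lt_of_lt_of_le (by exact_mod_cast hi) hgR)
    have hMext : ∀ i < g, Subsingleton
        (Abelian.Ext.{u} (ModuleCat.of R (R ⧸ I)) (ModuleCat.of R M) i) := fun i hi =>
      subsingleton_ext_of_lt_grade (lt_of_lt_of_le (by exact_mod_cast hi) hgM)
    have hadd := koszulComplex_homology_inAdd x hF hx
    have key := tensorExact_opcycles (L := augmentedResolution P) (K := koszulComplex x) (m := m)
      koszulComplex_flat ?_ ?_ (m - 1) 0 (by lia)
    · rw [Nat.sub_add_cancel (by lia)] at key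
      exact AugmentedResolution.TensorExact.of_inAdd (opcycles_zero_inAdd hx) key
    · intro q i hqi
      -- Otherwise q + 1 ≤ e - g, and m > e - g + n with q + i + 2 = m gives n ≤ i < m, so the
      -- inductive hypothesis covers Tor_i. Here n ≥ 1 also ensures i ≥ 1.
      by_cases hq : (e : ℤ) < (q : ℤ) + 1 + g
      · exact Or.inl (koszulComplex_isZero_homology hRext hadd g _ hq hq)
      · refine Or.inr ⟨by lia, AugmentedResolution.TensorExact.of_inAdd (hadd _) ?_⟩
        exact (tensorExact_iff_isZero_tor P _ _ (by lia)).2 (ih i (by lia) (by lia))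
    · intro q hq
      -- The degree q + 1 = m lies above e - g, because m + g > e + n.
      have h := koszulTensor_exactAt hx hMext g (q + 1) (by lia) (by lia)
      rw [HomologicalComplex.exactAt_iff' _ (q + 1 + 1) (q + 1) q (by simp) (by simp),
        ShortComplex.ShortExact.moduleCat_exact_iff_function_exact] at h
      exact h

end

end QuasiProj

end

theorem theorem7p4 {R : Type u} [CommRing R] [IsNoetherianRing R] (I : Ideal R) (hI : I ≠ ⊤)
    (hFKH : QuasiProj.IsFKH I) :
    QuasiProj.qpd R (R ⧸ I) = ((QuasiProj.grade I R : ℕ∞) : WithBot ℕ∞) ∧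
    ∀ (e : ℕ) (x : Fin e → R), Ideal.span (Set.range x) = I →
      ∀ (M : Type u) [AddCommGroup M] [Module R M] (n : ℕ), 1 ≤ n →
        (∀ i : ℕ, n ≤ i →
          (i : ℕ∞) + min (QuasiProj.grade I R) (QuasiProj.grade I M) ≤ (e : ℕ∞) + (n : ℕ∞) →
          IsZero (((Tor (ModuleCat.{u} R) i).obj (ModuleCat.of R (R ⧸ I))).obj
            (ModuleCat.of R M))) →
        ∀ i : ℕ, n ≤ i →
          IsZero (((Tor (ModuleCat.{u} R) i).obj (ModuleCat.of R (R ⧸ I))).obj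
            (ModuleCat.of R M)) := by
  obtain ⟨hqpd, hfin⟩ := QuasiProj.qpd_eq_grade_and_grade_ne_top hI hFKH
  refine ⟨hqpd, fun e x hx M _ _ n hn hT i hi => ?_⟩
  -- Finiteness of grade I makes the minimum a natural number even when grade(I, M) is infinite.
  obtain ⟨g, hg⟩ := ENat.ne_top_iff_exists.1
    (ne_top_of_le_ne_top hfin (min_le_left (QuasiProj.grade I R) (QuasiProj.grade I M)))
  refine QuasiProj.isZero_tor_of_isZero_tor hFKH hx M hn (g := g) (hg ▸ min_le_left _ _)
    (hg ▸ min_le_right _ _) (fun i hi hle => hT i hi ?_) i hi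
  rw [← hg]
  exact_mod_cast hle
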